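/- Let $k\ge 1$ be an integer and $0\le\alpha<1$, let $\mathbb D=\{z\in\mathbb C:|z|<1\}$, and let $d$ denote Euclidean distance. Let $S^{k*}_{LH}(\alpha)$ be the class of univalent mappings $f:\mathbb D\to\mathbb C$ of the form $f(z)=z\,h(z)\overline{g(z)}$ with $h,g$ analytic in $\mathbb D$, $$h(z)=\exp\Big(\sum_{n=1}^\infty a_{nk}z^{nk}\Big),\qquad g(z)=\exp\Big(\sum_{n=1}^\infty b_{nk}z^{nk}\Big),$$ that are $k$-fold symmetric, $f(e^{2\pi i/k}z)=e^{2\pi i/k}f(z)$, logharmonic, that is, $\overline{f_{\bar z}}/\overline{f}=\omega f_z/f$ for some analytic $\omega$ on $\mathbb D$ with $|\omega|<1$, and starlike of order $\alpha$, that is, $\operatorname{Re}\big((zf_z-\bar z f_{\bar z})/f\big)>\alpha$ in $\mathbb D\setminus\{0\}$. **Theorem.** The equation $$\frac{2^{2\alpha/k}\,r\,\big(2-(1+2\alpha)r^k+r^{2k}\big)}{(1-r^k)^{2(\alpha+k)/k}}\exp\Big(\frac{2(1-\alpha)(1+r^k)}{k(1-r^k)}\Big)=1$$ has a unique root $r_6$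 in $(0,1)$. For every $f\in S^{k*}_{LH}(\alpha)$ with $\omega(0)=0$ and every real $\theta$, $$|zf_z(z)|+|z|\exp\Big(\sum_{n=1}^\infty|a_{nk}+e^{i\theta}b_{nk}|\,|z|^{nk}\Big)\le d\big(f(0),\partial f(\mathbb D)\big)\qquad\text{for }|z|\le r_6,$$ where the series converges. The radius $r_6$ is best possible: for every $\rho\in(r_6,1)$ there are $f\in S^{k*}_{LH}(\alpha)$ with $\omega(0)=0$, a real $\theta$ and a point $z$ with $|z|=\rho$ for which the inequality fails. -/

import Mathlib

open scoped ComplexConjugate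

noncomputable section

/-- The Wirtinger derivative `f_z = (f_x - i f_y) / 2`. -/
def wirtingerZ (f : ℂ → ℂ) (z : ℂ) : ℂ :=
  (fderiv ℝ f z 1 - Complex.I * fderiv ℝ f z Complex.I) / 2

/-- The Wirtinger derivative `f_{z̄} = (f_x + i f_y) / 2`. -/
def wirtingerZbar (f : ℂ → ℂ) (z : ℂ) : ℂ :=
  (fderiv ℝ f z 1 + Complex.I * fderiv ℝ f z Complex.I) / 2

/-- The open unit disk. -/
def unitDisk : Set ℂ := Metric.ball 0 1

/-- `f` is a solution in the unit disk of `conj(f_{z̄}) / conj(f) = ω f_z / f`, where the second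
dilatation `ω` is analytic with `|ω| < 1`. The equation is written without denominators, so that
at the zeros of `f` (for the mappings below only the origin) it imposes nothing. -/
structure IsLogharmonicWith (f ω : ℂ → ℂ) : Prop where
  realDifferentiable : ∀ z ∈ unitDisk, DifferentiableAt ℝ f z
  dilatation_analytic : AnalyticOnNhd ℂ ω unitDisk
  dilatation_lt_one : ∀ z ∈ unitDisk, ‖ω z‖ < 1
  equation : ∀ z ∈ unitDisk,
    conj (wirtingerZbar f z) * f z = ω z * wirtingerZ f z * conj (f z)

/-- `f(e^{2πi/k} z) = e^{2πi/k} f(z)` in the unit disk. -/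
def IsKFoldSymmetric (k : ℕ) (f : ℂ → ℂ) : Prop :=
  ∀ z ∈ unitDisk,
    f (Complex.exp (2 * Real.pi * Complex.I / k) * z)
      = Complex.exp (2 * Real.pi * Complex.I / k) * f z

/-- `Re (D f / f) > α`, `D f = z f_z - z̄ f_{z̄}`. The origin, where the quotient is `0 / 0`
(with limit `1`), is left out. -/
def IsStarlikeOfOrder (α : ℝ) (f : ℂ → ℂ) : Prop :=
  ∀ z ∈ unitDisk, z ≠ 0 →
    α < ((z * wirtingerZ f z - conj z * wirtingerZbar f z) / f z).re

/-- `u(z) = exp (∑_{n ≥ 1} c_{nk} z^{nk})` in the unit disk, with a series that converges there. -/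
def IsExpSeries (k : ℕ) (c : ℕ → ℂ) (u : ℂ → ℂ) : Prop :=
  ∀ z ∈ unitDisk, ∃ s : ℂ,
    HasSum (fun n : ℕ => c ((n + 1) * k) * z ^ ((n + 1) * k)) s ∧ u z = Complex.exp s

/-- `f = z h conj(g)` belongs to the class `S_LH^{k*}(α)`, where `h` and `g` are the exponentials
of the power series with coefficients `a_{nk}` and `b_{nk}`, and where `f` is logharmonic with
second dilatation `ω`. -/
structure IsSLHkStar (k : ℕ) (α : ℝ) (f h g ω : ℂ → ℂ) (a b : ℕ → ℂ) : Prop where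
  h_analytic : AnalyticOnNhd ℂ h unitDisk
  g_analytic : AnalyticOnNhd ℂ g unitDisk
  h_series : IsExpSeries k a h
  g_series : IsExpSeries k b g
  representation : ∀ z ∈ unitDisk, f z = z * h z * conj (g z)
  univalent : Set.InjOn f unitDisk
  logharmonic : IsLogharmonicWith f ω
  symmetric : IsKFoldSymmetric k f
  starlike : IsStarlikeOfOrder α f

/-- The terms `|a_{nk} + e^{iθ} b_{nk}| |z|^{nk}`; the index `n : ℕ` stands for `n + 1 ≥ 1`. -/
def bohrTerm (k : ℕ) (a b : ℕ → ℂ) (θ : ℝ) (z : ℂ) (n : ℕ) : ℝ :=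
  ‖a ((n + 1) * k) + Complex.exp (θ * Complex.I) * b ((n + 1) * k)‖ * ‖z‖ ^ ((n + 1) * k)

/-- `|z f_z(z)| + |z| exp (∑_{n ≥ 1} |a_{nk} + e^{iθ} b_{nk}| |z|^{nk})`. -/
def bohrMajorant (k : ℕ) (f : ℂ → ℂ) (a b : ℕ → ℂ) (θ : ℝ) (z : ℂ) : ℝ :=
  ‖z * wirtingerZ f z‖ + ‖z‖ * Real.exp (∑' n : ℕ, bohrTerm k a b θ z n)

/-- The Euclidean distance from `f(0)` to the boundary of the image of the unit disk. -/
def boundaryDist (f : ℂ → ℂ) : ℝ :=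
  Metric.infDist (f 0) (frontier (f '' unitDisk))

/-- The left-hand side of the equation that determines the radius. -/
def radiusFunction (k : ℕ) (α r : ℝ) : ℝ :=
  (2 : ℝ) ^ (2 * α / k) * r * (2 - (1 + 2 * α) * r ^ k + r ^ (2 * k))
      / (1 - r ^ k) ^ (2 * (α + k) / k)
    * Real.exp (2 * (1 - α) * (r ^ k + 1) / (k * (1 - r ^ k)))

end

/-! Write `f = z exp A(z^k) conj (exp B(z^k))` and put `x = z^k`, `U = 1 + k x A'(x)`, `V = k x
B'(x)`. Then `z f_z = f U` and `z̄ f_z̄ = f V̄`, so starlikeness says `Re (U - V) > α` and the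
dilatation equation says `|V| < |U|`. With `p = U - V` and `q = (U + V) / (U - V)` this becomes `Re
p > α`, `Re q > 0`, `p(0) = q(0) = 1`, and `U = p (q + 1) / 2`, `V = p (q - 1) / 2`
(`exists_caratheodory`).

Upper bound. Carathéodory's bounds for the coefficients of `p` and `q`, multiplied out, bound every
coefficient of `A`, `B` and `U`. Summing them bounds the Bohr series, `|f|` and `|U|` at once, hence
the left-hand side by `sharpMajorant` (`bohrMajorant_le`).

Lower bound. `H = k (A + B)` solves `x H' = p q - 1`. It splits as `α K + (1 - α) H₁` with `x K' = q
- 1` and `1 + x H₁'` a product of two functions of positive real part. Harnack gives `Re K ≥ -2 log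
2`, and an argument at a point of least modulus with `Re H₁ ≤ -2` gives `Re H₁ > -2`. So `|f(z)| ≥
|z| * coveringRadius`. As `f` is open and injective, frontier points of the image are limits of
values along sequences tending to the unit circle, and the distance to the frontier is at least
`coveringRadius`.

The radius equation says exactly `sharpMajorant = coveringRadius`, and `sharpMajorant` is strictly
increasing.

Sharpness. For `q = (1 + x) / (1 - x)` and `p = (1 + (1 - 2α) x) / (1 - x)` all coefficient bounds
are equalities on the positive axis, and the boundary value at a `k`-th root of `-1` has modulus
`coveringRadius`. The remaining point is univalence of this mapping. Its `k`-th power, in the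
variable `y = 1 / (1 - z^k)`, is studied through the angles of the triangle `0, 1, y`: on curves of
constant argument the modulus is strictly monotone (`strictMonoOn_triangleModulus`). -/

open Metric Set Filter Topology

/-! ### Power series in the unit disk -/

/-- `F` is the sum of the power series with coefficients `c` in the unit disk. -/
def HasDiskSeries (F : ℂ → ℂ) (c : ℕ → ℂ) : Prop :=
  ∀ x ∈ ball (0 : ℂ) 1, HasSum (fun n => c n * x ^ n) (F x)

theorem HasDiskSeries.hasFPowerSeriesAt {F : ℂ → ℂ} {c : ℕ → ℂ} (h : HasDiskSeries F c) :
    HasFPowerSeriesAt F (FormalMultilinearSeries.ofScalars ℂ c) 0 := by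
  rw [hasFPowerSeriesAt_iff]
  filter_upwards [ball_mem_nhds (0 : ℂ) one_pos] with z hz
  simpa [FormalMultilinearSeries.coeff_ofScalars, mul_comm] using h z hz

theorem HasDiskSeries.unique {F : ℂ → ℂ} {c d : ℕ → ℂ} (hc : HasDiskSeries F c)
    (hd : HasDiskSeries F d) : c = d := by
  have h := hc.hasFPowerSeriesAt.eq_formalMultilinearSeries hd.hasFPowerSeriesAt
  funext n
  have := congrArg (fun p => FormalMultilinearSeries.coeff p n) h
  simpa [FormalMultilinearSeries.coeff_ofScalars] using this

theorem hasDiskSeries_taylor {F : ℂ → ℂ} (hF : DifferentiableOn ℂ F (ball 0 1)) :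
    HasDiskSeries F (fun n => (n.factorial : ℂ)⁻¹ * iteratedDeriv n F 0) := by
  intro x hx
  have := Complex.hasSum_taylorSeries_on_ball hF hx
  refine this.congr_fun fun n => ?_
  simp only [sub_zero, smul_eq_mul]; ring

theorem HasDiskSeries.apply_zero {F : ℂ → ℂ} {c : ℕ → ℂ} (h : HasDiskSeries F c) :
    F 0 = c 0 := by
  have h1 := h 0 (by simp)
  have h2 : HasSum (fun n => c n * (0 : ℂ) ^ n) (c 0 * 0 ^ 0) :=
    hasSum_single 0 (fun n hn => by simp [hn])
  simpa using h1.unique h2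

theorem HasDiskSeries.summable_norm {F : ℂ → ℂ} {c : ℕ → ℂ} (h : HasDiskSeries F c) {x : ℂ}
    (hx : x ∈ ball (0 : ℂ) 1) : Summable fun n => ‖c n * x ^ n‖ :=
  (h x hx).summable.norm

/-- Convergence at each real point `r < 1` already forces the radius of convergence to be at least
`1`. -/
theorem HasDiskSeries.differentiableOn {F : ℂ → ℂ} {c : ℕ → ℂ} (h : HasDiskSeries F c) :
    DifferentiableOn ℂ F (ball 0 1) := by
  have hb : HasFPowerSeriesOnBall F (FormalMultilinearSeries.ofScalars ℂ c) 0 1 := by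
    refine ⟨?_, one_pos, ?_⟩
    · refine ENNReal.le_of_forall_nnreal_lt fun r hr => ?_
      have hr' : (r : ℝ) < 1 := by exact_mod_cast hr
      have hs := h.summable_norm (x := ((r : ℝ) : ℂ)) (by simpa using hr')
      refine FormalMultilinearSeries.le_radius_of_summable_norm _ (hs.congr fun n => ?_)
      rw [FormalMultilinearSeries.ofScalars_norm]
      simp
    · intro y hy
      have hy' : y ∈ ball (0 : ℂ) 1 := by
        rw [← ENNReal.ofReal_one, Metric.eball_ofReal] at hy; exact hy
      simpa [FormalMultilinearSeries.ofScalars_apply_eq, zero_add, mul_comm] using h y hy'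
  have := hb.differentiableOn
  intro x hx
  refine (this x ?_).mono ?_
  · rw [← ENNReal.ofReal_one, Metric.eball_ofReal]; exact hx
  · rw [← ENNReal.ofReal_one, Metric.eball_ofReal]

theorem HasDiskSeries.mul {F G : ℂ → ℂ} {c d : ℕ → ℂ} (hF : HasDiskSeries F c)
    (hG : HasDiskSeries G d) : HasDiskSeries (fun x => F x * G x)
      (fun n => ∑ ij ∈ Finset.HasAntidiagonal.antidiagonal n, c ij.1 * d ij.2) := by
  intro x hx
  have e : ∀ n, (∑ ij ∈ Finset.HasAntidiagonal.antidiagonal n, c ij.1 * d ij.2) * x ^ n =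
      ∑ ij ∈ Finset.HasAntidiagonal.antidiagonal n, (c ij.1 * x ^ ij.1) * (d ij.2 * x ^ ij.2) := by
    intro n
    rw [Finset.sum_mul]
    refine Finset.sum_congr rfl fun ij hij => ?_
    rw [← Finset.HasAntidiagonal.mem_antidiagonal.1 hij, pow_add]; ring
  have h1 := tsum_mul_tsum_eq_tsum_sum_antidiagonal_of_summable_norm
    (hF.summable_norm hx) (hG.summable_norm hx)
  have h2 := (summable_norm_sum_mul_antidiagonal_of_summable_norm
    (hF.summable_norm hx) (hG.summable_norm hx)).of_norm
  rw [(hF x hx).tsum_eq, (hG x hx).tsum_eq] at h1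
  simp only [e]
  rw [h1]
  exact h2.hasSum

theorem HasDiskSeries.mul_deriv {F : ℂ → ℂ} {c : ℕ → ℂ} (h : HasDiskSeries F c) :
    HasDiskSeries (fun x => x * deriv F x) (fun n => n * c n) := by
  have hd : DifferentiableOn ℂ (deriv F) (ball 0 1) := h.differentiableOn.deriv isOpen_ball
  have hc : c = _ := h.unique (hasDiskSeries_taylor h.differentiableOn)
  intro x hx
  have h1 := (hasDiskSeries_taylor hd x hx).mul_left x
  rw [← hasSum_nat_add_iff' 1]
  simp only [Finset.range_one, Finset.sum_singleton, Nat.cast_zero, zero_mul, sub_zero]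
  refine h1.congr_fun fun n => ?_
  rw [hc]
  simp only [iteratedDeriv_succ', Nat.factorial_succ, pow_succ]
  have : ((n : ℂ) + 1) ≠ 0 := by exact_mod_cast Nat.succ_ne_zero n
  push_cast
  field_simp

/-! ### Carathéodory's and Harnack's inequalities -/

theorem HasDiskSeries.circleAverage {F : ℂ → ℂ} {c : ℕ → ℂ} (h : HasDiskSeries F c) {r : ℝ}
    (hr0 : 0 < r) (hr1 : r < 1) (n : ℕ) :
    Real.circleAverage (fun x => ((r : ℂ) / x) ^ n * F x) 0 r = c n * (r : ℂ) ^ n := by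
  have hsub : closedBall (0 : ℂ) r ⊆ ball 0 1 := closedBall_subset_ball hr1
  lift r to NNReal using hr0.le
  have h1 := ((h.differentiableOn.mono hsub).hasFPowerSeriesOnBall
    (by exact_mod_cast hr0)).hasFPowerSeriesAt.eq_formalMultilinearSeries h.hasFPowerSeriesAt
  have h2 := congrArg (fun p => (p n) fun _ => ((r : ℝ) : ℂ)) h1
  simp only [cauchyPowerSeries_apply] at h2
  rw [Real.circleAverage_eq_circleIntegral hr0.ne']
  simp only [sub_zero, smul_eq_mul] at h2 ⊢
  have h3 : (FormalMultilinearSeries.ofScalars ℂ c n) (fun _ => ((r : ℝ) : ℂ))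
      = c n * ((r : ℝ) : ℂ) ^ n := by
    simp [mul_comm]
  rw [← h3, ← h2]
  congr 2
  funext z
  ring

/-- **Carathéodory's coefficient bound.** -/
theorem HasDiskSeries.norm_coeff_le_two {F : ℂ → ℂ} {c : ℕ → ℂ} (h : HasDiskSeries F c)
    (h0 : F 0 = 1) (hre : ∀ x ∈ ball (0 : ℂ) 1, 0 ≤ (F x).re) {n : ℕ} (hn : n ≠ 0) :
    ‖c n‖ ≤ 2 := by
  have key : ∀ r : ℝ, 0 < r → r < 1 → ‖c n‖ * r ^ n ≤ 2 := by
    intro r hr0 hr1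
    have hsub : closedBall (0 : ℂ) r ⊆ ball 0 1 := closedBall_subset_ball hr1
    have hsph : sphere (0 : ℂ) |r| ⊆ ball 0 1 := by
      rw [abs_of_pos hr0]; exact sphere_subset_closedBall.trans hsub
    have hFc : ContinuousOn F (sphere (0 : ℂ) |r|) := h.differentiableOn.continuousOn.mono hsph
    have hx0 : ∀ x ∈ sphere (0 : ℂ) |r|, x ≠ 0 := by
      rintro x hx rfl
      simp at hx; linarith [abs_pos.2 hr0.ne']
    have hkc : ContinuousOn (fun x : ℂ => ((r : ℂ) / x) ^ n) (sphere (0 : ℂ) |r|) :=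
      (continuousOn_const.div continuousOn_id hx0).pow n
    have e1 := h.circleAverage hr0 hr1 n
    -- On the circle `r / x = conj x / r`, so the integrand is the conjugate of an analytic function
    -- vanishing at `0`. Adding it to `e1` replaces `F` by `2 Re F`, which is nonnegative and has
    -- mean `2`.
    have e2 : Real.circleAverage (fun x => ((r : ℂ) / x) ^ n * conj (F x)) 0 r = 0 := by
      have hdc : DiffContOnCl ℂ (fun x => (x / (r : ℂ)) ^ n * F x) (ball (0 : ℂ) |r|) := by
        refine DifferentiableOn.diffContOnCl_ball (U := ball 0 1) ?_
          (by rw [abs_of_pos hr0]; exact hsub)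
        exact ((differentiable_id.div_const _).pow n).differentiableOn.mul h.differentiableOn
      have h3 := hdc.circleAverage
      have h4 := (Complex.conjCLE : ℂ ≃L[ℝ] ℂ).toContinuousLinearMap.circleAverage_comp_comm
        (f := fun x => (x / (r : ℂ)) ^ n * F x) (c := 0) (R := r)
        (ContinuousOn.circleIntegrable' (((continuousOn_id.div_const _).pow n).mul hFc))
      rw [h3] at h4
      have h5 : (Complex.conjCLE : ℂ ≃L[ℝ] ℂ).toContinuousLinearMap
        (((0 : ℂ) / (r : ℂ)) ^ n * F 0) = 0 := by simp [hn]
      rw [h5] at h4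
      refine Eq.trans ?_ h4
      refine Real.circleAverage_congr_sphere fun x hx => ?_
      have hx' : x * conj x = (r : ℂ) ^ 2 := by
        rw [Complex.mul_conj, Complex.normSq_eq_norm_sq]
        have : ‖x‖ = r := by simpa [abs_of_pos hr0] using hx
        rw [this]; push_cast; ring
      have hr : (r : ℂ) ≠ 0 := by exact_mod_cast hr0.ne'
      have : (r : ℂ) / x = conj x / r := by
        rw [div_eq_div_iff (hx0 x hx) hr]; rw [mul_comm (conj x), hx']; ring
      simp [this]
    have i1 : CircleIntegrable (fun x => ((r : ℂ) / x) ^ n * F x) 0 r :=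
      ContinuousOn.circleIntegrable' (hkc.mul hFc)
    have i2 : CircleIntegrable (fun x => ((r : ℂ) / x) ^ n * conj (F x)) 0 r :=
      ContinuousOn.circleIntegrable' (hkc.mul (Complex.continuous_conj.comp_continuousOn hFc))
    have e3 := Real.circleAverage_fun_add i1 i2
    rw [e1, e2, add_zero] at e3
    have hm : Real.circleAverage (fun x => 2 * (F x).re) 0 r = 2 := by
      have h3 := (h.differentiableOn.diffContOnCl_ball
        (R := |r|) (by rw [abs_of_pos hr0]; exact hsub)).circleAverage
      have h4 := Complex.reCLM.circleAverage_comp_comm (f := F) (c := 0) (R := r)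
        (ContinuousOn.circleIntegrable' hFc)
      rw [h3, h0] at h4
      have h5 := Real.circleAverage_fun_smul (a := (2 : ℝ)) (f := fun x => (F x).re)
        (c := 0) (R := r)
      simp only [smul_eq_mul] at h5
      rw [h5]
      have h6 : Real.circleAverage (fun x => (F x).re) 0 r = 1 := by
        rw [← Complex.one_re]; exact h4
      rw [h6]; norm_num
    have hb : ‖Real.circleAverage
        (fun x => ((r : ℂ) / x) ^ n * F x + ((r : ℂ) / x) ^ n * conj (F x)) 0 r‖
        ≤ Real.circleAverage (fun x => 2 * (F x).re) 0 r := by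
      rw [Real.circleAverage_def, Real.circleAverage_def, norm_smul, smul_eq_mul]
      have hpi : (0 : ℝ) < (2 * Real.pi)⁻¹ := by positivity
      rw [Real.norm_of_nonneg hpi.le]
      refine mul_le_mul_of_nonneg_left ?_ hpi.le
      refine intervalIntegral.norm_integral_le_of_norm_le (by positivity) ?_ ?_
      · refine Eventually.of_forall fun t _ => ?_
        set x := circleMap 0 r t
        have hx : x ∈ sphere (0 : ℂ) |r| := circleMap_mem_sphere' 0 r t
        have hxn : ‖x‖ = r := by simpa [abs_of_pos hr0] using hx
        rw [← mul_add, Complex.add_conj, norm_mul, norm_pow, norm_div, hxn]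
        simp only [Complex.norm_real, Real.norm_of_nonneg hr0.le, div_self hr0.ne', one_pow, one_mul]
        rw [Real.norm_of_nonneg]
        have := hre x (hsph hx); linarith
      · have : CircleIntegrable (fun x => 2 * (F x).re) 0 r :=
          ContinuousOn.circleIntegrable'
            (continuousOn_const.mul (Complex.continuous_re.comp_continuousOn hFc))
        exact this
    rw [hm, e3, norm_mul, norm_pow, Complex.norm_real, Real.norm_of_nonneg hr0.le] at hb
    exact hb
  have ht : Tendsto (fun r : ℝ => ‖c n‖ * r ^ n) (𝓝[<] 1) (𝓝 (‖c n‖ * 1 ^ n)) :=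
    ((continuous_const.mul (continuous_pow n)).tendsto 1).mono_left nhdsWithin_le_nhds
  rw [one_pow, mul_one] at ht
  refine le_of_tendsto ht ?_
  filter_upwards [Ioo_mem_nhdsLT (zero_lt_one' ℝ)] with r hr
  exact key r hr.1 hr.2

/-- **Harnack's inequality** from below for the real part of an analytic function. -/
theorem harnack_re {G : ℂ → ℂ} {s : ℝ} (hG : DifferentiableOn ℂ G (ball 0 s)) (h0 : G 0 = 1)
    (hre : ∀ x ∈ ball (0 : ℂ) s, 0 < (G x).re) {x : ℂ} (hx : x ∈ ball (0 : ℂ) s) :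
    (s - ‖x‖) / (s + ‖x‖) ≤ (G x).re := by
  have hxs : ‖x‖ < s := by simpa using hx
  have hs : 0 < s := (norm_nonneg x).trans_lt hxs
  have hne : ∀ y ∈ ball (0 : ℂ) s, G y + 1 ≠ 0 := fun y hy h => by
    have := congrArg Complex.re h
    have := hre y hy
    simp at *; linarith
  -- The Cayley transform sends the right half plane into the disk; the Schwarz lemma is applied to
  -- it.
  have hd : DifferentiableOn ℂ (fun y => (G y - 1) / (G y + 1)) (ball 0 s) :=
    (hG.sub_const 1).div (hG.add_const 1) hne
  have hm : MapsTo (fun y => (G y - 1) / (G y + 1)) (ball 0 s)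
      (closedBall ((fun y => (G y - 1) / (G y + 1)) 0) 1) := by
    intro y hy
    have hp := hre y hy
    simp only [h0, sub_self, zero_div, mem_closedBall_zero_iff, norm_div]
    rw [div_le_one (norm_pos_iff.2 (hne y hy))]
    refine (sq_le_sq₀ (norm_nonneg _) (norm_nonneg _)).1 ?_
    rw [← Complex.normSq_eq_norm_sq, ← Complex.normSq_eq_norm_sq, Complex.normSq_apply,
      Complex.normSq_apply]
    simp; nlinarith
  have h1 := Complex.dist_le_div_mul_dist_of_mapsTo_ball hd hm hx
  simp only [h0, sub_self, zero_div, dist_zero_right, norm_div] at h1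
  set t := ‖x‖ / s with ht
  have ht0 : 0 ≤ t := by positivity
  have ht1 : t < 1 := (div_lt_one hs).2 hxs
  have ha := hre x hx
  have h2 : ‖G x - 1‖ ≤ t * ‖G x + 1‖ := by
    rw [div_le_iff₀ (norm_pos_iff.2 (hne x hx))] at h1
    calc _ ≤ _ := h1
      _ = _ := by rw [ht]; ring
  have h3 : ‖G x - 1‖ ^ 2 ≤ (t * ‖G x + 1‖) ^ 2 := by gcongr
  rw [mul_pow, ← Complex.normSq_eq_norm_sq, ← Complex.normSq_eq_norm_sq, Complex.normSq_apply,
      Complex.normSq_apply] at h3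
  simp only [Complex.sub_re, Complex.one_re, Complex.sub_im, Complex.one_im, sub_zero,
    Complex.add_re, Complex.add_im, add_zero] at h3
  have h4 : ((G x).re - 1) ^ 2 ≤ (t * ((G x).re + 1)) ^ 2 := by
    have : t ^ 2 ≤ 1 := by nlinarith
    nlinarith [mul_nonneg (sub_nonneg.2 this) (mul_self_nonneg (G x).im)]
  have h5 := abs_le_of_sq_le_sq' h4 (by positivity)
  have h6 : ‖x‖ = t * s := by rw [ht]; field_simp
  rw [h6, div_le_iff₀ (by positivity)]
  have h7 := h5.1
  nlinarith

/-! ### Lower bounds for the real part of solutions of `x H' = p q - 1` -/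

theorem hasDerivAt_comp_ray {H : ℂ → ℂ} {x : ℂ} {t : ℝ} (hd : DifferentiableAt ℂ H (t * x)) :
    HasDerivAt (fun t : ℝ => (H (t * x)).re) (x * deriv H (t * x)).re t := by
  have h1 : HasDerivAt (fun z : ℂ => H (z * x)) (deriv H (t * x) * x) (t : ℂ) := by
    have h2 : HasDerivAt (fun z : ℂ => z * x) x (t : ℂ) := by
      simpa using (hasDerivAt_id (t : ℂ)).mul_const x
    exact HasDerivAt.comp (t : ℂ) hd.hasDerivAt h2
  have := h1.real_of_complex
  rwa [mul_comm x]

/-- By Harnack, `Re q - 1 ≥ -2ρ / (1 + ρ)` at radius `ρ`, which is `ρ` times the derivative of `-2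
log (1 + ρ)`. Hence `Re H + 2 log (1 + ρ)` increases along rays. -/
theorem re_ge_neg_two_mul_log {H q : ℂ → ℂ} (hH : DifferentiableOn ℂ H (ball 0 1))
    (hH0 : H 0 = 0) (hq : DifferentiableOn ℂ q (ball 0 1)) (hq0 : q 0 = 1)
    (hre : ∀ x ∈ ball (0 : ℂ) 1, 0 < (q x).re)
    (hode : ∀ x ∈ ball (0 : ℂ) 1, x * deriv H x = q x - 1) {x : ℂ} (hx : x ∈ ball (0 : ℂ) 1) :
    -(2 * Real.log 2) ≤ (H x).re := by
  have hx1 : ‖x‖ < 1 := by simpa using hx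
  have hmem : ∀ t ∈ Icc (0 : ℝ) 1, (t : ℂ) * x ∈ ball (0 : ℂ) 1 := by
    intro t ht
    rw [mem_ball_zero_iff, norm_mul, Complex.norm_real, Real.norm_of_nonneg ht.1]
    exact (mul_le_of_le_one_left (norm_nonneg x) ht.2).trans_lt hx1
  have hd : ∀ t ∈ Icc (0 : ℝ) 1, HasDerivAt
      (fun t : ℝ => (H (t * x)).re + 2 * Real.log (1 + t * ‖x‖))
      ((x * deriv H (t * x)).re + 2 * (‖x‖ / (1 + t * ‖x‖))) t := by
    intro t ht
    have h1 := hasDerivAt_comp_ray (hH.differentiableAt (isOpen_ball.mem_nhds (hmem t ht)))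
    have h2 : HasDerivAt (fun t : ℝ => 1 + t * ‖x‖) ‖x‖ t := by
      simpa using ((hasDerivAt_id t).mul_const ‖x‖).const_add 1
    have hpos : 0 < 1 + t * ‖x‖ := by have := mul_nonneg ht.1 (norm_nonneg x); linarith
    exact h1.add ((h2.log hpos.ne').const_mul 2)
  have hmono : MonotoneOn (fun t : ℝ => (H (t * x)).re + 2 * Real.log (1 + t * ‖x‖))
      (Icc 0 1) := by
    refine monotoneOn_of_deriv_nonneg (convex_Icc 0 1)
      (fun t ht => (hd t ht).continuousAt.continuousWithinAt) ?_ ?_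
    · intro t ht
      rw [interior_Icc] at ht
      exact (hd t (Ioo_subset_Icc_self ht)).differentiableAt.differentiableWithinAt
    · intro t ht
      rw [interior_Icc] at ht
      rw [(hd t (Ioo_subset_Icc_self ht)).deriv]
      have hm := hmem t (Ioo_subset_Icc_self ht)
      have h1 := harnack_re hq hq0 hre hm
      rw [norm_mul, Complex.norm_real, Real.norm_of_nonneg ht.1.le] at h1
      have h2 := congrArg Complex.re (hode _ hm)
      rw [mul_assoc, Complex.re_ofReal_mul, Complex.sub_re, Complex.one_re] at h2
      have hpos : 0 < 1 + t * ‖x‖ := by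
        have := mul_nonneg ht.1.le (norm_nonneg x); linarith
      refine nonneg_of_mul_nonneg_right ?_ ht.1
      rw [mul_add, h2]
      have : (1 - t * ‖x‖) / (1 + t * ‖x‖) - 1 + t * (2 * (‖x‖ / (1 + t * ‖x‖))) = 0 := by
        field_simp; ring
      linarith
  have h := hmono (left_mem_Icc.2 zero_le_one) (right_mem_Icc.2 zero_le_one) zero_le_one
  simp only [Complex.ofReal_zero, zero_mul, hH0, Complex.zero_re, add_zero, Real.log_one, mul_zero,
    Complex.ofReal_one, one_mul] at h
  have : Real.log (1 + ‖x‖) ≤ Real.log 2 :=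
    Real.log_le_log (by positivity) (by linarith)
  linarith

/-- If `1 + x H'(x)` is a product of two functions with positive real part, then `Re H > -2`. -/
theorem neg_two_lt_re {H p q : ℂ → ℂ} (hH : DifferentiableOn ℂ H (ball 0 1)) (hH0 : H 0 = 0)
    (hp : ∀ x ∈ ball (0 : ℂ) 1, 0 < (p x).re) (hq : ∀ x ∈ ball (0 : ℂ) 1, 0 < (q x).re)
    (hode : ∀ x ∈ ball (0 : ℂ) 1, x * deriv H x = p x * q x - 1) {x : ℂ}
    (hx : x ∈ ball (0 : ℂ) 1) : -2 < (H x).re := by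
  by_contra! hcon
  have hx1 : ‖x‖ < 1 := by simpa using hx
  have hsub : closedBall (0 : ℂ) ‖x‖ ⊆ ball 0 1 := closedBall_subset_ball hx1
  have hcont : ContinuousOn (fun y => (H y).re) (ball 0 1) :=
    Complex.continuous_re.comp_continuousOn hH.continuousOn
  have hK : IsCompact (closedBall (0 : ℂ) ‖x‖ ∩ (fun y => (H y).re) ⁻¹' Iic (-2)) :=
    (isCompact_closedBall _ _).of_isClosed_subset
      ((hcont.mono hsub).preimage_isClosed_of_isClosed isClosed_closedBall isClosed_Iic)
      inter_subset_left
  -- A point of least modulus with `Re H ≤ -2`: inside the circle through it `Re H > -2`, and on the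
  -- circle `Re H ≥ -2`.
  obtain ⟨z, ⟨hzx, hzH⟩, hmin⟩ := hK.exists_isMinOn ⟨x, by simp, hcon⟩ continuous_norm.continuousOn
  have hzH : (H z).re ≤ -2 := hzH
  have hz1 : z ∈ ball (0 : ℂ) 1 := hsub hzx
  have hzn : ‖z‖ ≤ ‖x‖ := by simpa using hzx
  have hz0 : z ≠ 0 := by rintro rfl; rw [hH0] at hzH; norm_num at hzH
  have hzpos : 0 < ‖z‖ := norm_pos_iff.2 hz0
  have hin : ∀ y ∈ ball (0 : ℂ) ‖z‖, -2 < (H y).re := by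
    intro y hy
    by_contra! hy2
    have hyz : ‖y‖ < ‖z‖ := by simpa using hy
    have : ‖z‖ ≤ ‖y‖ := hmin ⟨by simpa using hyz.le.trans hzn, hy2⟩
    linarith
  have hzc : ∀ y, ‖y‖ = ‖z‖ → -2 ≤ (H y).re := by
    intro y hy
    have hyc : y ∈ closure (ball (0 : ℂ) ‖z‖) := by
      rw [closure_ball _ hzpos.ne']; simp [hy]
    have hyb : y ∈ ball (0 : ℂ) 1 := hsub (by simp [hy, hzn])
    have : ContinuousWithinAt (fun y => (H y).re) (ball 0 ‖z‖) y :=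
      (hcont.continuousAt (isOpen_ball.mem_nhds hyb)).continuousWithinAt
    have hne : (𝓝[ball (0 : ℂ) ‖z‖] y).NeBot := mem_closure_iff_nhdsWithin_neBot.1 hyc
    exact ge_of_tendsto this.tendsto
      (eventually_nhdsWithin_of_forall fun w hw => (hin w hw).le)
  have hzeq : (H z).re = -2 := le_antisymm hzH (hzc z rfl)
  have hdz : DifferentiableAt ℂ H z := hH.differentiableAt (isOpen_ball.mem_nhds hz1)
  -- `Re H` is minimal at `z` on its circle, so its angular derivative vanishes.
  have him : (z * deriv H z).im = 0 := by
    have hE : HasDerivAt (fun t : ℂ => z * Complex.exp (t * Complex.I)) (z * Complex.I)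
        ((0 : ℝ) : ℂ) := by
      have h1 : HasDerivAt (fun t : ℂ => t * Complex.I) Complex.I ((0 : ℝ) : ℂ) := by
        simpa using (hasDerivAt_id ((0 : ℝ) : ℂ)).mul_const Complex.I
      simpa using (h1.cexp).const_mul z
    have h2 : HasDerivAt (fun t : ℂ => H (z * Complex.exp (t * Complex.I)))
        (deriv H z * (z * Complex.I)) ((0 : ℝ) : ℂ) := by
      refine HasDerivAt.comp ((0 : ℝ) : ℂ) (h₂ := H) ?_ hE
      simpa using hdz.hasDerivAt
    have h3 := h2.real_of_complex
    have h4 : IsLocalMin (fun t : ℝ => (H (z * Complex.exp (t * Complex.I))).re) 0 := by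
      refine Eventually.of_forall fun t => ?_
      simp only [Complex.ofReal_zero, zero_mul, Complex.exp_zero, mul_one]
      rw [hzeq]
      exact hzc _ (by rw [norm_mul, Complex.norm_exp_ofReal_mul_I, mul_one])
    have h5 := h4.hasDerivAt_eq_zero h3
    rw [← mul_assoc, Complex.mul_I_re, mul_comm] at h5
    linarith
  -- Harnack for `(H + 2) / 2` on the disk of radius `‖z‖` gives a lower bound on the ray to `z`
  -- that is attained at `t = 1` with slope `-1`.
  have hrad : (z * deriv H z).re ≤ -1 := by
    have hG : ∀ t ∈ Ioo (0 : ℝ) 1, -2 + 2 * ((1 - t) / (1 + t)) ≤ (H (t * z)).re := by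
      intro t ht
      have hmem : (t : ℂ) * z ∈ ball (0 : ℂ) ‖z‖ := by
        rw [mem_ball_zero_iff, norm_mul, Complex.norm_real, Real.norm_of_nonneg ht.1.le]
        exact mul_lt_of_lt_one_left hzpos ht.2
      have h1 := harnack_re (G := fun y => (H y + 2) / 2) (s := ‖z‖)
        (((hH.mono ((ball_subset_ball hzn).trans
          (ball_subset_closedBall.trans hsub))).add_const 2).div_const 2)
        (by simp [hH0]) (fun y hy => by
          have := hin y hy
          have e : ((H y + 2) / 2).re = ((H y).re + 2) / 2 := by
            rw [show (2 : ℂ) = ((2 : ℝ) : ℂ) by simp, Complex.div_ofReal_re]; simp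
          simp only [e]; linarith) hmem
      have e : ((H (t * z) + 2) / 2).re = ((H (t * z)).re + 2) / 2 := by
        rw [show (2 : ℂ) = ((2 : ℝ) : ℂ) by simp, Complex.div_ofReal_re]; simp
      simp only [e] at h1
      rw [norm_mul, Complex.norm_real, Real.norm_of_nonneg ht.1.le] at h1
      have h2 : (‖z‖ - t * ‖z‖) / (‖z‖ + t * ‖z‖) = (1 - t) / (1 + t) := by
        have : 0 < 1 + t := by linarith [ht.1]
        rw [div_eq_div_iff (by nlinarith) this.ne']; ring
      rw [h2] at h1
      linarith
    have h1 : HasDerivAt (fun t : ℝ => (H (t * z)).re) (z * deriv H z).re 1 := by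
      have := hasDerivAt_comp_ray (H := H) (x := z) (t := 1) (by simpa using hdz)
      simpa using this
    have h2 : HasDerivAt (fun t : ℝ => -2 + 2 * ((1 - t) / (1 + t))) (-1) 1 := by
      have ha : HasDerivAt (fun t : ℝ => 1 - t) (-1) 1 := by
        simpa using (hasDerivAt_id (1 : ℝ)).const_sub 1
      have hb : HasDerivAt (fun t : ℝ => 1 + t) 1 1 := by
        simpa using (hasDerivAt_id (1 : ℝ)).const_add 1
      have := ((ha.div hb (by norm_num)).const_mul 2).const_add (-2)
      convert! this using 1
      norm_num
    have h3 := (h1.sub h2).tendsto_slope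
    have h4 : (z * deriv H z).re - -1 ≤ 0 := by
      refine le_of_tendsto (h3.mono_left (nhdsWithin_mono 1 (s := Iio (1 : ℝ))
        (fun t ht => ne_of_lt ht))) ?_
      filter_upwards [Ioo_mem_nhdsLT (zero_lt_one' ℝ)] with t ht
      rw [slope_def_field]
      refine div_nonpos_of_nonneg_of_nonpos ?_ (by linarith [ht.2])
      have := hG t ht
      simp only [Pi.sub_apply, Complex.ofReal_one, one_mul, hzeq]
      norm_num
      linarith
    linarith
  have hpz := hp z hz1
  have hqz := hq z hz1
  have hre := congrArg Complex.re (hode z hz1)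
  have hi := congrArg Complex.im (hode z hz1)
  rw [him] at hi
  simp only [Complex.sub_re, Complex.sub_im, Complex.one_re, Complex.one_im, sub_zero] at hre hi
  have hle : (p z * q z).re ≤ 0 := by linarith
  rw [Complex.mul_re] at hle
  rw [Complex.mul_im] at hi
  -- Now `p q = 1 + z H'` is real and nonpositive. This contradicts `Re (conj p * (p q)) = |p|² Re q
  -- > 0`.
  have h1 : (p z).re * ((p z).re * (q z).re - (p z).im * (q z).im) ≤ 0 :=
    mul_nonpos_of_nonneg_of_nonpos hpz.le hle
  have h2 : (p z).im * ((p z).re * (q z).im + (p z).im * (q z).re) = 0 := by rw [← hi, mul_zero]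
  have h3 : 0 < ((p z).re * (p z).re + (p z).im * (p z).im) * (q z).re :=
    mul_pos (by nlinarith [mul_self_nonneg (p z).im, mul_pos hpz hpz]) hqz
  linarith

/-- Since `p q - 1 = α (q - 1) + (1 - α) (((p - α) / (1 - α)) q - 1)`, the two preceding bounds
combine with weights `α` and `1 - α`. -/
theorem neg_le_re_of_mul_deriv_eq {α : ℝ} (hα0 : 0 ≤ α) (hα1 : α < 1) {H p q : ℂ → ℂ}
    (hH : DifferentiableOn ℂ H (ball 0 1)) (hH0 : H 0 = 0)
    (hq : DifferentiableOn ℂ q (ball 0 1)) (hq0 : q 0 = 1)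
    (hpre : ∀ x ∈ ball (0 : ℂ) 1, α < (p x).re) (hqre : ∀ x ∈ ball (0 : ℂ) 1, 0 < (q x).re)
    (hode : ∀ x ∈ ball (0 : ℂ) 1, x * deriv H x = p x * q x - 1) {x : ℂ}
    (hx : x ∈ ball (0 : ℂ) 1) : -(2 * α * Real.log 2) - 2 * (1 - α) ≤ (H x).re := by
  have hds : DifferentiableOn ℂ (dslope q 0) (ball 0 1) :=
    (Complex.differentiableOn_dslope (isOpen_ball.mem_nhds (by simp))).2 hq
  -- `K` is the primitive of `(q(x) - 1) / x` vanishing at `0`.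
  obtain ⟨K, hK0, hK⟩ := hds.isExactOn_ball.with_val_at 0 0
  have hKd : DifferentiableOn ℂ K (ball 0 1) :=
    fun y hy => (hK y hy).differentiableAt.differentiableWithinAt
  have hKode : ∀ y ∈ ball (0 : ℂ) 1, y * deriv K y = q y - 1 := by
    intro y hy
    rw [(hK y hy).deriv]
    have := sub_smul_dslope q 0 y
    simpa [hq0] using this
  have hα : (1 - (α : ℂ)) ≠ 0 := by
    rw [← Complex.ofReal_one, ← Complex.ofReal_sub]
    exact_mod_cast (sub_pos.2 hα1).ne'
  have h1 := re_ge_neg_two_mul_log hKd hK0 hq hq0 hqre hKode hx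
  have h2 := neg_two_lt_re (H := fun y => (H y - α * K y) / ((1 - α : ℝ) : ℂ))
    (p := fun y => (p y - α) / ((1 - α : ℝ) : ℂ)) (q := q)
    ((hH.sub (hKd.const_mul _)).div_const _) (by simp [hH0, hK0])
    (fun y hy => by
      simp only [Complex.div_ofReal_re]
      have := hpre y hy
      refine div_pos ?_ (by linarith)
      simpa using this) hqre
    (fun y hy => by
      have hHy := (hH.differentiableAt (isOpen_ball.mem_nhds hy)).hasDerivAt
      have hKy := (hKd.differentiableAt (isOpen_ball.mem_nhds hy)).hasDerivAt
      have hHK : HasDerivAt (fun y => (H y - α * K y) / ((1 - α : ℝ) : ℂ))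
          ((deriv H y - α * deriv K y) / ((1 - α : ℝ) : ℂ)) y :=
        (hHy.sub (hKy.const_mul (α : ℂ))).div_const _
      rw [hHK.deriv]
      have e1 := hode y hy
      have e2 := hKode y hy
      push_cast
      field_simp
      linear_combination e1 - α * e2) hx
  simp only [Complex.div_ofReal_re, Complex.sub_re, Complex.re_ofReal_mul] at h2
  rw [lt_div_iff₀ (by linarith)] at h2
  nlinarith

/-! ### Coefficient bounds for `p (q ± 1) / 2` -/

section Coefficients

variable {α : ℝ} {p q : ℂ → ℂ} {u : ℕ → ℂ}

theorem HasDiskSeries.norm_coeff_le_of_lt_re (hα1 : α < 1) {c : ℕ → ℂ} (h : HasDiskSeries p c)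
    (hp0 : p 0 = 1) (hpre : ∀ x ∈ ball (0 : ℂ) 1, α < (p x).re) {n : ℕ} (hn : n ≠ 0) :
    ‖c n‖ ≤ 2 * (1 - α) := by
  have hα : (((1 - α : ℝ)) : ℂ) ≠ 0 := by exact_mod_cast (sub_pos.2 hα1).ne'
  have hP : HasDiskSeries (fun x => (p x - α) / ((1 - α : ℝ) : ℂ))
      (fun n => (c n - if n = 0 then (α : ℂ) else 0) / ((1 - α : ℝ) : ℂ)) := by
    intro x hx
    have h1 : HasSum (fun n : ℕ => (if n = 0 then (α : ℂ) else 0) * x ^ n) α := by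
      have := hasSum_single (f := fun n : ℕ => (if n = 0 then (α : ℂ) else 0) * x ^ n) 0
        (fun n hn => by simp [hn])
      simpa using this
    refine (((h x hx).sub h1).div_const _).congr_fun fun n => ?_
    ring
  have := hP.norm_coeff_le_two (by
      simp only [hp0]; push_cast at hα ⊢; exact div_self hα) (fun x hx => by
    simp only [Complex.div_ofReal_re]
    have := hpre x hx
    refine div_nonneg ?_ (by linarith)
    simpa using this.le) hn
  simp only [hn, if_false, sub_zero, norm_div, Complex.norm_real,
    Real.norm_of_nonneg (sub_pos.2 hα1).le] at this
  rwa [div_le_iff₀ (sub_pos.2 hα1)] at this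

theorem HasDiskSeries.half_add_one {c : ℕ → ℂ} (h : HasDiskSeries q c) (e : ℂ) :
    HasDiskSeries (fun x => (q x + e) / 2) (fun n => (c n + if n = 0 then e else 0) / 2) := by
  intro x hx
  have h1 : HasSum (fun n : ℕ => (if n = 0 then e else 0) * x ^ n) e := by
    have := hasSum_single (f := fun n : ℕ => (if n = 0 then e else 0) * x ^ n) 0
      (fun n hn => by simp [hn])
    simpa using this
  refine (((h x hx).add h1).div_const _).congr_fun fun n => ?_
  ring

/-- In the Cauchy product every coefficient of `(q + 1) / 2` has modulus at most `1`, including the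
constant one, while those of `p` are `1` and then at most `2 (1 - α)`. -/
theorem norm_coeff_mul_half_add_le (hα1 : α < 1)
    (hp : DifferentiableOn ℂ p (ball 0 1)) (hp0 : p 0 = 1)
    (hq : DifferentiableOn ℂ q (ball 0 1)) (hq0 : q 0 = 1)
    (hpre : ∀ x ∈ ball (0 : ℂ) 1, α < (p x).re) (hqre : ∀ x ∈ ball (0 : ℂ) 1, 0 < (q x).re)
    (hu : HasDiskSeries (fun x => p x * ((q x + 1) / 2)) u) (n : ℕ) :
    ‖u n‖ ≤ 1 + 2 * n * (1 - α) := by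
  have hc := hasDiskSeries_taylor hp
  have hd := hasDiskSeries_taylor hq
  set c := fun n : ℕ => ((n.factorial : ℂ)⁻¹ * iteratedDeriv n p 0)
  set d := fun n : ℕ => ((n.factorial : ℂ)⁻¹ * iteratedDeriv n q 0)
  have hc0 : c 0 = 1 := by rw [← hc.apply_zero, hp0]
  have hd0 : d 0 = 1 := by rw [← hd.apply_zero, hq0]
  rw [hu.unique (hc.mul (hd.half_add_one 1))]
  have hs : ∀ j, ‖(d j + if j = 0 then (1 : ℂ) else 0) / 2‖ ≤ 1 := by
    intro j
    by_cases hj : j = 0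
    · subst hj; simp [hd0]
    · have := hd.norm_coeff_le_two hq0 (fun x hx => (hqre x hx).le) hj
      simp only [hj, if_false, add_zero, norm_div, Complex.norm_two]; linarith
  simp only
  rw [Finset.Nat.sum_antidiagonal_eq_sum_range_succ
    (fun i j => c i * ((d j + if j = 0 then (1 : ℂ) else 0) / 2)) n]
  refine (norm_sum_le _ _).trans ?_
  rw [Finset.sum_range_succ']
  have h0 : ‖c 0 * ((d (n - 0) + if n - 0 = 0 then (1 : ℂ) else 0) / 2)‖ ≤ 1 := by
    rw [hc0, one_mul]; exact hs _
  have h1 : ∀ i ∈ Finset.range n,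
      ‖c (i + 1) * ((d (n - (i + 1)) + if n - (i + 1) = 0 then (1 : ℂ) else 0) / 2)‖
        ≤ 2 * (1 - α) := by
    intro i _
    rw [norm_mul]
    have := hc.norm_coeff_le_of_lt_re hα1 hp0 hpre (Nat.succ_ne_zero i)
    calc _ ≤ (2 * (1 - α)) * 1 := mul_le_mul this (hs _) (norm_nonneg _) (by linarith)
      _ = _ := mul_one _
  have := Finset.sum_le_sum h1
  rw [Finset.sum_const, Finset.card_range, nsmul_eq_mul] at this
  linarith

/-- The constant term of `(q - 1) / 2` is zero, so the Cauchy product has one term fewer. This is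
why the bound at index `n + 1` involves only `n`. -/
theorem norm_coeff_mul_half_sub_le (hα1 : α < 1)
    (hp : DifferentiableOn ℂ p (ball 0 1)) (hp0 : p 0 = 1)
    (hq : DifferentiableOn ℂ q (ball 0 1)) (hq0 : q 0 = 1)
    (hpre : ∀ x ∈ ball (0 : ℂ) 1, α < (p x).re) (hqre : ∀ x ∈ ball (0 : ℂ) 1, 0 < (q x).re)
    (hu : HasDiskSeries (fun x => p x * ((q x + -1) / 2)) u) (n : ℕ) :
    ‖u (n + 1)‖ ≤ 1 + 2 * n * (1 - α) := by
  have hc := hasDiskSeries_taylor hp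
  have hd := hasDiskSeries_taylor hq
  set c := fun n : ℕ => ((n.factorial : ℂ)⁻¹ * iteratedDeriv n p 0)
  set d := fun n : ℕ => ((n.factorial : ℂ)⁻¹ * iteratedDeriv n q 0)
  have hc0 : c 0 = 1 := by rw [← hc.apply_zero, hp0]
  have hd0 : d 0 = 1 := by rw [← hd.apply_zero, hq0]
  rw [hu.unique (hc.mul (hd.half_add_one (-1)))]
  have hs : ∀ j, ‖(d j + if j = 0 then (-1 : ℂ) else 0) / 2‖ ≤ 1 := by
    intro j
    by_cases hj : j = 0
    · subst hj; simp [hd0]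
    · have := hd.norm_coeff_le_two hq0 (fun x hx => (hqre x hx).le) hj
      simp only [hj, if_false, add_zero, norm_div, Complex.norm_two]; linarith
  simp only
  rw [Finset.Nat.sum_antidiagonal_eq_sum_range_succ
    (fun i j => c i * ((d j + if j = 0 then (-1 : ℂ) else 0) / 2)) (n + 1)]
  refine (norm_sum_le _ _).trans ?_
  rw [Finset.sum_range_succ, Finset.sum_range_succ']
  have h0 : ‖c 0 * ((d (n + 1 - 0) + if n + 1 - 0 = 0 then (-1 : ℂ) else 0) / 2)‖ ≤ 1 := by
    rw [hc0, one_mul]; exact hs _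
  have h2 : ‖c (n + 1) * ((d (n + 1 - (n + 1)) +
      if n + 1 - (n + 1) = 0 then (-1 : ℂ) else 0) / 2)‖ = 0 := by
    simp [hd0]
  have h1 : ∀ i ∈ Finset.range n,
      ‖c (i + 1) * ((d (n + 1 - (i + 1)) + if n + 1 - (i + 1) = 0 then (-1 : ℂ) else 0) / 2)‖
        ≤ 2 * (1 - α) := by
    intro i _
    rw [norm_mul]
    have := hc.norm_coeff_le_of_lt_re hα1 hp0 hpre (Nat.succ_ne_zero i)
    calc _ ≤ (2 * (1 - α)) * 1 := mul_le_mul this (hs _) (norm_nonneg _) (by linarith)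
      _ = _ := mul_one _
  have := Finset.sum_le_sum h1
  rw [Finset.sum_const, Finset.card_range, nsmul_eq_mul] at this
  linarith

end Coefficients

/-! ### Wirtinger derivatives -/

/-- The real-linear map `v ↦ a v + b v̄`. -/
noncomputable def wirtingerMap (a b : ℂ) : ℂ →L[ℝ] ℂ :=
  a • ContinuousLinearMap.id ℝ ℂ + b • (Complex.conjCLE : ℂ ≃L[ℝ] ℂ).toContinuousLinearMap

theorem wirtingerMap_apply (a b v : ℂ) : wirtingerMap a b v = a * v + b * conj v := by
  simp [wirtingerMap]

theorem wirtingerZ_eq {f : ℂ → ℂ} {a b z : ℂ} (h : HasFDerivAt f (wirtingerMap a b) z) :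
    wirtingerZ f z = a := by
  rw [wirtingerZ, h.fderiv, wirtingerMap_apply, wirtingerMap_apply]
  simp only [map_one, Complex.conj_I]
  linear_combination (-(a - b) / 2) * Complex.I_mul_I

theorem wirtingerZbar_eq {f : ℂ → ℂ} {a b z : ℂ} (h : HasFDerivAt f (wirtingerMap a b) z) :
    wirtingerZbar f z = b := by
  rw [wirtingerZbar, h.fderiv, wirtingerMap_apply, wirtingerMap_apply]
  simp only [map_one, Complex.conj_I]
  linear_combination ((a - b) / 2) * Complex.I_mul_I

/-- The Jacobian `|a|² - |b|²` is positive: `a v = -b v̄` forces `v = 0`, and in finite dimension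
injectivity suffices. -/
theorem wirtingerMap_surjective {a b : ℂ} (hab : ‖b‖ < ‖a‖) :
    (wirtingerMap a b).range = ⊤ := by
  rw [LinearMap.range_eq_top]
  refine LinearMap.injective_iff_surjective.1 ?_
  rw [injective_iff_map_eq_zero]
  intro v hv
  have hv : wirtingerMap a b v = 0 := hv
  rw [wirtingerMap_apply] at hv
  by_contra hv0
  have h1 : ‖a * v‖ = ‖b * conj v‖ := by
    rw [eq_neg_of_add_eq_zero_left hv, norm_neg]
  rw [norm_mul, norm_mul, RCLike.norm_conj] at h1
  have := mul_right_cancel₀ (norm_ne_zero_iff.2 hv0) h1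
  linarith

theorem hasStrictFDerivAt_mul_conj {F G : ℂ → ℂ} {F' G' z : ℂ} (hF : HasStrictDerivAt F F' z)
    (hG : HasStrictDerivAt G G' z) :
    HasStrictFDerivAt (fun z => F z * conj (G z))
      (wirtingerMap (F' * conj (G z)) (F z * conj G')) z := by
  have h1 := (hF.hasStrictFDerivAt.restrictScalars ℝ)
  have h2 := (Complex.conjCLE : ℂ ≃L[ℝ] ℂ).toContinuousLinearMap.hasStrictFDerivAt.comp z
    (hG.hasStrictFDerivAt.restrictScalars ℝ)
  refine (h1.mul h2).congr_fderiv ?_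
  ext v
  simp [wirtingerMap]
  ring

/-! ### Reduction of the class to pairs of exponents -/

/-- The exponents `A`, `B` of a starlike logharmonic mapping `z exp A(z^k) conj (exp B(z^k))`. -/
structure IsStarlikePair (k : ℕ) (α : ℝ) (A B : ℂ → ℂ) : Prop where
  diffA : DifferentiableOn ℂ A (ball 0 1)
  diffB : DifferentiableOn ℂ B (ball 0 1)
  A_zero : A 0 = 0
  B_zero : B 0 = 0
  lt_re : ∀ x ∈ ball (0 : ℂ) 1, α < (1 + k * (x * deriv A x) - k * (x * deriv B x)).re
  norm_lt : ∀ x ∈ ball (0 : ℂ) 1, ‖k * (x * deriv B x)‖ < ‖1 + k * (x * deriv A x)‖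

/-- `f = z exp A(z^k) conj (exp B(z^k))` in the unit disk. -/
def HasExponents (k : ℕ) (A B f : ℂ → ℂ) : Prop :=
  ∀ z ∈ ball (0 : ℂ) 1, f z = z * Complex.exp (A (z ^ k)) * conj (Complex.exp (B (z ^ k)))

theorem pow_mem_ball_zero_one {k : ℕ} (hk : 1 ≤ k) {z : ℂ} (hz : z ∈ ball (0 : ℂ) 1) :
    z ^ k ∈ ball (0 : ℂ) 1 := by
  rw [mem_ball_zero_iff] at hz ⊢
  rw [norm_pow]
  exact pow_lt_one₀ (norm_nonneg z) hz (by omega)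

theorem exists_pow_eq_mem_ball {k : ℕ} (hk : 1 ≤ k) {x : ℂ} (hx : x ∈ ball (0 : ℂ) 1) :
    ∃ z ∈ ball (0 : ℂ) 1, z ^ k = x := by
  obtain ⟨z, hz⟩ := IsAlgClosed.exists_pow_nat_eq x (show 0 < k by omega)
  refine ⟨z, ?_, hz⟩
  rw [mem_ball_zero_iff] at hx ⊢
  rw [← hz, norm_pow] at hx
  by_contra! h
  exact absurd (one_le_pow₀ h) (not_le.2 hx)

/-- Each point of the disk is a `k`-th power of a point of the disk, so convergence in `z` gives
convergence in `x = z^k`. -/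
theorem IsExpSeries.exists_hasDiskSeries {k : ℕ} (hk : 1 ≤ k) {c : ℕ → ℂ} {u : ℂ → ℂ}
    (h : IsExpSeries k c u) : ∃ A : ℂ → ℂ,
      HasDiskSeries A (fun n => if n = 0 then 0 else c (n * k)) ∧
      ∀ z ∈ ball (0 : ℂ) 1, u z = Complex.exp (A (z ^ k)) := by
  have hs : ∀ z ∈ ball (0 : ℂ) 1, ∃ s : ℂ,
      HasSum (fun n : ℕ => (if n = 0 then 0 else c (n * k)) * (z ^ k) ^ n) s ∧
      u z = Complex.exp s := by
    intro z hz
    obtain ⟨s, h1, h2⟩ := h z hz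
    refine ⟨s, ?_, h2⟩
    rw [← hasSum_nat_add_iff' 1]
    simp only [Finset.range_one, Finset.sum_singleton, if_true, zero_mul, sub_zero]
    refine h1.congr_fun fun n => ?_
    rw [if_neg (Nat.succ_ne_zero n), ← pow_mul, mul_comm k]
  refine ⟨fun x => ∑' n : ℕ, (if n = 0 then 0 else c (n * k)) * x ^ n, ?_, ?_⟩
  · intro x hx
    obtain ⟨z, hz, rfl⟩ := exists_pow_eq_mem_ball hk hx
    obtain ⟨s, h1, -⟩ := hs z hz
    exact h1.summable.hasSum
  · intro z hz
    obtain ⟨s, h1, h2⟩ := hs z hz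
    rw [h2]; simp only [h1.tsum_eq]

theorem IsExpSeries.of_hasDiskSeries {k : ℕ} (hk : 1 ≤ k) {c : ℕ → ℂ} {A : ℂ → ℂ}
    (h : HasDiskSeries A c) (hc : c 0 = 0) :
    IsExpSeries k (fun m => c (m / k)) (fun z => Complex.exp (A (z ^ k))) := by
  intro z hz
  refine ⟨A (z ^ k), ?_, rfl⟩
  have h1 := h _ (pow_mem_ball_zero_one hk hz)
  rw [← hasSum_nat_add_iff' 1] at h1
  simp only [Finset.range_one, Finset.sum_singleton, hc, zero_mul, sub_zero] at h1
  refine h1.congr_fun fun n => ?_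
  change c ((n + 1) * k / k) * z ^ ((n + 1) * k) = _
  rw [Nat.mul_div_cancel _ (by omega), ← pow_mul, mul_comm k]

section Exponents

variable {k : ℕ} {A B f : ℂ → ℂ}

theorem hasStrictDerivAt_exp_comp_pow (hk : 1 ≤ k) (hA : DifferentiableOn ℂ A (ball 0 1)) {z : ℂ}
    (hz : z ∈ ball (0 : ℂ) 1) :
    HasStrictDerivAt (fun z => Complex.exp (A (z ^ k)))
      (Complex.exp (A (z ^ k)) * (deriv A (z ^ k) * (k * z ^ (k - 1)))) z := by
  have hx := pow_mem_ball_zero_one hk hz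
  have hAn : AnalyticAt ℂ A (z ^ k) := hA.analyticAt (isOpen_ball.mem_nhds hx)
  have h1 : HasStrictDerivAt (fun z : ℂ => z ^ k) (k * z ^ (k - 1)) z := hasStrictDerivAt_pow k z
  exact (hAn.hasStrictDerivAt.comp z h1).cexp

/-- Strict differentiability is what the open mapping argument for `f` needs later. -/
theorem HasExponents.hasStrictFDerivAt (hk : 1 ≤ k) (hA : DifferentiableOn ℂ A (ball 0 1))
    (hB : DifferentiableOn ℂ B (ball 0 1)) (hf : HasExponents k A B f) {z : ℂ}
    (hz : z ∈ ball (0 : ℂ) 1) :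
    HasStrictFDerivAt f (wirtingerMap
      (Complex.exp (A (z ^ k)) * conj (Complex.exp (B (z ^ k))) *
        (1 + k * (z ^ k * deriv A (z ^ k))))
      (z * Complex.exp (A (z ^ k)) * conj (Complex.exp (B (z ^ k)) *
        (deriv B (z ^ k) * (k * z ^ (k - 1)))))) z := by
  have h1 := hasStrictFDerivAt_mul_conj
    ((hasStrictDerivAt_id z).mul (hasStrictDerivAt_exp_comp_pow hk hA hz))
    (hasStrictDerivAt_exp_comp_pow hk hB hz)
  have h2 : (fun z => z * Complex.exp (A (z ^ k)) * conj (Complex.exp (B (z ^ k)))) =ᶠ[𝓝 z] f := by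
    filter_upwards [isOpen_ball.mem_nhds hz] with w hw
    exact (hf w hw).symm
  refine (HasStrictFDerivAt.congr_of_eventuallyEq h1 h2).congr_fderiv ?_
  congr 1
  have : z ^ k = z * z ^ (k - 1) := by rw [← pow_succ', Nat.sub_add_cancel hk]
  rw [id, this]; ring

theorem HasExponents.wirtingerZ_eq (hk : 1 ≤ k) (hA : DifferentiableOn ℂ A (ball 0 1))
    (hB : DifferentiableOn ℂ B (ball 0 1)) (hf : HasExponents k A B f) {z : ℂ}
    (hz : z ∈ ball (0 : ℂ) 1) :
    wirtingerZ f z = Complex.exp (A (z ^ k)) * conj (Complex.exp (B (z ^ k))) *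
        (1 + k * (z ^ k * deriv A (z ^ k))) :=
  _root_.wirtingerZ_eq (hf.hasStrictFDerivAt hk hA hB hz).hasFDerivAt

theorem HasExponents.mul_wirtingerZ (hk : 1 ≤ k) (hA : DifferentiableOn ℂ A (ball 0 1))
    (hB : DifferentiableOn ℂ B (ball 0 1)) (hf : HasExponents k A B f) {z : ℂ}
    (hz : z ∈ ball (0 : ℂ) 1) :
    z * wirtingerZ f z = f z * (1 + k * (z ^ k * deriv A (z ^ k))) := by
  rw [hf.wirtingerZ_eq hk hA hB hz, hf z hz]; ring

theorem HasExponents.conj_mul_wirtingerZbar (hk : 1 ≤ k) (hA : DifferentiableOn ℂ A (ball 0 1))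
    (hB : DifferentiableOn ℂ B (ball 0 1)) (hf : HasExponents k A B f) {z : ℂ}
    (hz : z ∈ ball (0 : ℂ) 1) :
    conj z * wirtingerZbar f z = f z * conj (k * (z ^ k * deriv B (z ^ k))) := by
  rw [wirtingerZbar_eq (hf.hasStrictFDerivAt hk hA hB hz).hasFDerivAt, hf z hz]
  have hc : conj (z ^ k) = conj z * conj (z ^ (k - 1)) := by
    rw [← map_mul, ← pow_succ', Nat.sub_add_cancel hk]
  simp only [map_mul, map_natCast]
  rw [hc]
  ring

theorem HasExponents.ne_zero (hf : HasExponents k A B f) {z : ℂ} (hz : z ∈ ball (0 : ℂ) 1)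
    (hz0 : z ≠ 0) : f z ≠ 0 := by
  rw [hf z hz]
  exact mul_ne_zero (mul_ne_zero hz0 (Complex.exp_ne_zero _))
    ((map_ne_zero _).2 (Complex.exp_ne_zero _))

theorem HasExponents.norm_eq (hf : HasExponents k A B f) {z : ℂ} (hz : z ∈ ball (0 : ℂ) 1) :
    ‖f z‖ = ‖z‖ * Real.exp ((A (z ^ k)).re + (B (z ^ k)).re) := by
  rw [hf z hz, norm_mul, norm_mul, RCLike.norm_conj, Complex.norm_exp, Complex.norm_exp,
    Real.exp_add, mul_assoc]

theorem HasExponents.map_zero (hf : HasExponents k A B f) : f 0 = 0 := by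
  rw [hf 0 (by simp)]; simp

/-- A mapping of the class `S_LH^{k*}(α)` with `ω(0) = 0` comes from a starlike pair. -/
theorem IsSLHkStar.exists_isStarlikePair (hk : 1 ≤ k) {α : ℝ} (hα0 : 0 ≤ α) (hα1 : α < 1)
    {h g ω : ℂ → ℂ} {a b : ℕ → ℂ} (hS : IsSLHkStar k α f h g ω a b) :
    ∃ A B : ℂ → ℂ, IsStarlikePair k α A B ∧ HasExponents k A B f ∧
      HasDiskSeries A (fun n => if n = 0 then 0 else a (n * k)) ∧
      HasDiskSeries B (fun n => if n = 0 then 0 else b (n * k)) := by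
  obtain ⟨A, hA, hhA⟩ := hS.h_series.exists_hasDiskSeries hk
  obtain ⟨B, hB, hgB⟩ := hS.g_series.exists_hasDiskSeries hk
  have hf : HasExponents k A B f := fun z hz => by
    rw [hS.representation z hz, hhA z hz, hgB z hz]
  have key : ∀ x ∈ ball (0 : ℂ) 1,
      α < (1 + k * (x * deriv A x) - k * (x * deriv B x)).re ∧
      ‖k * (x * deriv B x)‖ < ‖1 + k * (x * deriv A x)‖ := by
    intro x hx
    by_cases hx0 : x = 0
    · subst hx0; simpa using hα1
    obtain ⟨z, hz, rfl⟩ := exists_pow_eq_mem_ball hk hx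
    have hz0 : z ≠ 0 := by rintro rfl; exact hx0 (zero_pow (by omega))
    have e1 := hf.mul_wirtingerZ hk hA.differentiableOn hB.differentiableOn hz
    have e2 := hf.conj_mul_wirtingerZbar hk hA.differentiableOn hB.differentiableOn hz
    have hfz := hf.ne_zero hz hz0
    set U := 1 + k * (z ^ k * deriv A (z ^ k))
    set V := k * (z ^ k * deriv B (z ^ k))
    have hre : α < (U - V).re := by
      have := hS.starlike z hz hz0
      rw [e1, e2, ← mul_sub, mul_div_cancel_left₀ _ hfz] at this
      simpa using this
    refine ⟨hre, ?_⟩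
    have hcf : conj (f z) ≠ 0 := (map_ne_zero _).2 hfz
    -- The dilatation equation multiplied by `z` and divided by `|f|²`.
    have hV : V = ω z * U := by
      have h1 := hS.logharmonic.equation z hz
      have h2 := congrArg conj e2
      simp only [map_mul, Complex.conj_conj] at h2
      have h3 : (conj (f z) * f z) * V = (conj (f z) * f z) * (ω z * U) := by
        linear_combination z * h1 + (ω z * conj (f z)) * e1 - f z * h2
      exact mul_left_cancel₀ (mul_ne_zero hcf hfz) h3
    -- If `U = 0` then `V = ω U = 0` too, and `Re (U - V) = 0` would exceed `α ≥ 0`.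
    have hU : U ≠ 0 := by
      intro hU
      rw [hV, hU] at hre
      simp at hre; linarith
    rw [hV, norm_mul]
    exact mul_lt_of_lt_one_left (norm_pos_iff.2 hU) (hS.logharmonic.dilatation_lt_one z hz)
  exact ⟨A, B, ⟨hA.differentiableOn, hB.differentiableOn, by simpa using hA.apply_zero,
    by simpa using hB.apply_zero, fun x hx => (key x hx).1, fun x hx => (key x hx).2⟩, hf, hA, hB⟩

/-- A starlike pair whose mapping is injective gives a member of the class `S_LH^{k*}(α)`. -/
theorem IsStarlikePair.isSLHkStar (hk : 1 ≤ k) {α : ℝ} (hP : IsStarlikePair k α A B)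
    {a b : ℕ → ℂ} (hA : HasDiskSeries A a) (hB : HasDiskSeries B b)
    (hf : HasExponents k A B f) (hinj : InjOn f (ball 0 1)) :
    IsSLHkStar k α f (fun z => Complex.exp (A (z ^ k))) (fun z => Complex.exp (B (z ^ k)))
      (fun z => k * (z ^ k * deriv B (z ^ k)) / (1 + k * (z ^ k * deriv A (z ^ k))))
      (fun m => a (m / k)) (fun m => b (m / k)) := by
  have hU : ∀ x ∈ ball (0 : ℂ) 1, 1 + k * (x * deriv A x) ≠ 0 := fun x hx =>
    norm_pos_iff.1 ((norm_nonneg _).trans_lt (hP.norm_lt x hx))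
  have hpow : DifferentiableOn ℂ (fun z : ℂ => z ^ k) (ball 0 1) :=
    (differentiable_pow k).differentiableOn
  have hmaps : MapsTo (fun z : ℂ => z ^ k) (ball 0 1) (ball 0 1) := fun z hz => pow_mem_ball_zero_one hk hz
  have dA := hP.diffA.deriv isOpen_ball
  have dB := hP.diffB.deriv isOpen_ball
  refine ⟨?_, ?_, IsExpSeries.of_hasDiskSeries hk hA (by rw [← hA.apply_zero, hP.A_zero]),
    IsExpSeries.of_hasDiskSeries hk hB (by rw [← hB.apply_zero, hP.B_zero]), hf, hinj,
    ⟨?_, ?_, ?_, ?_⟩, ?_, ?_⟩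
  · exact (hP.diffA.comp hpow hmaps).cexp.analyticOnNhd isOpen_ball
  · exact (hP.diffB.comp hpow hmaps).cexp.analyticOnNhd isOpen_ball
  · exact fun z hz => (hf.hasStrictFDerivAt hk hP.diffA hP.diffB hz).hasFDerivAt.differentiableAt
  · refine DifferentiableOn.analyticOnNhd ?_ isOpen_ball
    exact ((hpow.mul (dB.comp hpow hmaps)).const_mul _).div
      (((hpow.mul (dA.comp hpow hmaps)).const_mul _).const_add _)
      (fun z hz => hU _ (pow_mem_ball_zero_one hk hz))
  · intro z hz
    have := hP.norm_lt _ (pow_mem_ball_zero_one hk hz)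
    rw [norm_div, div_lt_one ((norm_nonneg _).trans_lt this)]
    exact this
  · intro z hz
    by_cases hz0 : z = 0
    · subst hz0; simp [hf.map_zero]
    have e1 := hf.mul_wirtingerZ hk hP.diffA hP.diffB hz
    have e2 := hf.conj_mul_wirtingerZbar hk hP.diffA hP.diffB hz
    have h2 := congrArg conj e2
    simp only [map_mul, Complex.conj_conj] at h2
    have hUz := hU _ (pow_mem_ball_zero_one hk hz)
    refine mul_left_cancel₀ hz0 ?_
    have h3 : k * (z ^ k * deriv B (z ^ k)) / (1 + k * (z ^ k * deriv A (z ^ k))) *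
        (1 + k * (z ^ k * deriv A (z ^ k))) = k * (z ^ k * deriv B (z ^ k)) :=
      div_mul_cancel₀ _ hUz
    set W := k * (z ^ k * deriv B (z ^ k)) / (1 + k * (z ^ k * deriv A (z ^ k)))
    linear_combination f z * h2 - (W * conj (f z)) * e1 - (f z * conj (f z)) * h3
  · intro z hz
    set e := Complex.exp (2 * Real.pi * Complex.I / k) with he
    have hek : e ^ k = 1 := by
      rw [he, ← Complex.exp_nat_mul, mul_div_cancel₀ _ (by exact_mod_cast (by omega : k ≠ 0)),
        Complex.exp_two_pi_mul_I]
    have hen : ‖e‖ = 1 := by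
      refine (pow_eq_one_iff_of_nonneg (norm_nonneg e) (by omega : k ≠ 0)).1 ?_
      rw [← norm_pow, hek, norm_one]
    have hez : e * z ∈ ball (0 : ℂ) 1 := by
      have : ‖z‖ < 1 := by simpa [unitDisk] using hz
      simp [hen, this]
    rw [hf _ hez, hf z hz, mul_pow, hek, one_mul]; ring
  · intro z hz hz0
    rw [hf.mul_wirtingerZ hk hP.diffA hP.diffB hz,
      hf.conj_mul_wirtingerZbar hk hP.diffA hP.diffB hz, ← mul_sub,
      mul_div_cancel_left₀ _ (hf.ne_zero hz hz0)]
    have := hP.lt_re _ (pow_mem_ball_zero_one hk hz)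
    rwa [Complex.sub_re, Complex.conj_re, ← Complex.sub_re]

end Exponents

/-! ### The radius equation -/

/-- The distance from the origin to the omitted set of the extremal mapping. -/
noncomputable def coveringRadius (k : ℕ) (α : ℝ) : ℝ :=
  Real.exp ((-(2 * α * Real.log 2) - 2 * (1 - α)) / k)

/-- The exponent of the extremal growth of `h g`, in the variable `x = |z|^k`. -/
noncomputable def growthExponent (k : ℕ) (α x : ℝ) : ℝ :=
  (4 * (1 - α) * (x / (1 - x)) - 2 * α * Real.log (1 - x)) / k

/-- The sharp bound of the Bohr type majorant on the circle of radius `r`. -/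
noncomputable def sharpMajorant (k : ℕ) (α r : ℝ) : ℝ :=
  r * Real.exp (growthExponent k α (r ^ k)) *
    (1 + (1 + (1 - 2 * α) * r ^ k) / (1 - r ^ k) ^ 2)

theorem coveringRadius_pos (k : ℕ) (α : ℝ) : 0 < coveringRadius k α := Real.exp_pos _

theorem pow_lt_one_of_mem_Ico {k : ℕ} (hk : 1 ≤ k) {r : ℝ} (hr : r ∈ Ico (0 : ℝ) 1) :
    r ^ k ∈ Ico (0 : ℝ) 1 :=
  ⟨pow_nonneg hr.1 k, pow_lt_one₀ hr.1 hr.2 (by omega)⟩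

/-- Turns the radius equation into equality of the upper bound for the majorant and the lower bound
for the boundary distance. -/
theorem coveringRadius_mul_radiusFunction {k : ℕ} (hk : 1 ≤ k) (α : ℝ) {r : ℝ}
    (hr : r ∈ Ico (0 : ℝ) 1) :
    coveringRadius k α * radiusFunction k α r = sharpMajorant k α r := by
  have hx := pow_lt_one_of_mem_Ico hk hr
  have hk0 : (k : ℝ) ≠ 0 := by exact_mod_cast (by omega : k ≠ 0)
  have h1 : 0 < 1 - r ^ k := by linarith [hx.2]
  rw [radiusFunction, sharpMajorant, growthExponent, coveringRadius, mul_comm 2 k, pow_mul]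
  set x := r ^ k
  rw [Real.rpow_def_of_pos two_pos, Real.rpow_def_of_pos h1]
  have e1 : Real.log (1 - x) * (2 * (α + k) / k)
      = Real.log (1 - x) * (2 * α / k) + Real.log (1 - x) + Real.log (1 - x) := by
    field_simp; ring
  have e2 : (4 * (1 - α) * (x / (1 - x)) - 2 * α * Real.log (1 - x)) / k
      = (-(2 * α * Real.log 2) - 2 * (1 - α)) / k + Real.log 2 * (2 * α / k)
        + 2 * (1 - α) * (x + 1) / (k * (1 - x)) - Real.log (1 - x) * (2 * α / k) := by
    field_simp; ring
  rw [e1, e2, Real.exp_add _ (Real.log (1 - x)), Real.exp_add _ (Real.log (1 - x)),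
    Real.exp_log h1, Real.exp_sub, Real.exp_add _ (2 * (1 - α) * (x + 1) / (k * (1 - x))),
    Real.exp_add]
  have := Real.exp_pos (Real.log (1 - x) * (2 * α / k))
  field_simp
  ring

theorem sharpMajorant_strictMonoOn {k : ℕ} (hk : 1 ≤ k) {α : ℝ} (hα0 : 0 ≤ α) (hα1 : α < 1) :
    StrictMonoOn (sharpMajorant k α) (Ico 0 1) := by
  intro r hr s hs hrs
  have hx := pow_lt_one_of_mem_Ico hk hr
  have hy := pow_lt_one_of_mem_Ico hk hs
  have hxy : r ^ k ≤ s ^ k := pow_le_pow_left₀ hr.1 hrs.le k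
  have hk0 : (0 : ℝ) < k := by exact_mod_cast (by omega : 0 < k)
  rw [sharpMajorant, sharpMajorant, growthExponent, growthExponent]
  set x := r ^ k
  set y := s ^ k
  have h1 : 0 < 1 - x := by linarith [hx.2]
  have h2 : 0 < 1 - y := by linarith [hy.2]
  have i1 : x / (1 - x) ≤ y / (1 - y) := by
    rw [div_le_div_iff₀ h1 h2]; nlinarith
  have i2 : Real.log (1 - y) ≤ Real.log (1 - x) := Real.log_le_log h2 (by linarith)
  have i3 : (1 + (1 - 2 * α) * x) / (1 - x) ^ 2 ≤ (1 + (1 - 2 * α) * y) / (1 - y) ^ 2 := by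
    -- In this form every factor is nonnegative and nondecreasing, even when `1 - 2α < 0`.
    have e : ∀ t : ℝ, 0 < 1 - t → (1 + (1 - 2 * α) * t) / (1 - t) ^ 2
        = α * (1 / (1 - t)) + (1 - α) * (1 + t) * (1 / (1 - t)) ^ 2 := by
      intro t ht; field_simp; ring
    rw [e x h1, e y h2]
    have i4 : 1 / (1 - x) ≤ 1 / (1 - y) := one_div_le_one_div_of_le h2 (by linarith)
    have i5 : 0 ≤ 1 / (1 - x) := by positivity
    have i6 : 0 ≤ 1 - α := by linarith
    have i7 : 0 ≤ (1 - α) * (1 + y) := mul_nonneg i6 (by linarith [hy.1])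
    gcongr
  have i8 : 0 ≤ 1 + (1 + (1 - 2 * α) * x) / (1 - x) ^ 2 := by
    have : 0 ≤ 1 + (1 - 2 * α) * x := by nlinarith [hx.1, hx.2]
    positivity
  have i9 : 0 < 1 + (1 + (1 - 2 * α) * x) / (1 - x) ^ 2 := by
    have : 0 ≤ 1 + (1 - 2 * α) * x := by nlinarith [hx.1, hx.2]
    positivity
  have i10 : (4 * (1 - α) * (x / (1 - x)) - 2 * α * Real.log (1 - x)) / k ≤
      (4 * (1 - α) * (y / (1 - y)) - 2 * α * Real.log (1 - y)) / k := by
    have : 0 ≤ 1 - α := by linarith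
    gcongr
  have i11 := Real.exp_le_exp.2 i10
  have hs0 : 0 ≤ s := hs.1
  calc _ < s * Real.exp ((4 * (1 - α) * (x / (1 - x)) - 2 * α * Real.log (1 - x)) / k) *
          (1 + (1 + (1 - 2 * α) * x) / (1 - x) ^ 2) := by gcongr
    _ ≤ _ := by gcongr

theorem radiusFunction_strictMonoOn {k : ℕ} (hk : 1 ≤ k) {α : ℝ} (hα0 : 0 ≤ α) (hα1 : α < 1) :
    StrictMonoOn (radiusFunction k α) (Ico 0 1) := by
  intro r hr s hs hrs
  have := sharpMajorant_strictMonoOn hk hα0 hα1 hr hs hrs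
  rw [← coveringRadius_mul_radiusFunction hk α hr,
    ← coveringRadius_mul_radiusFunction hk α hs] at this
  exact lt_of_mul_lt_mul_left this (coveringRadius_pos k α).le

theorem radiusFunction_continuousOn {k : ℕ} (hk : 1 ≤ k) (α : ℝ) :
    ContinuousOn (radiusFunction k α) (Ico 0 1) := by
  have hk0 : (k : ℝ) ≠ 0 := by exact_mod_cast (by omega : k ≠ 0)
  have hne : ∀ r ∈ Ico (0 : ℝ) 1, 0 < 1 - r ^ k := fun r hr => by
    linarith [(pow_lt_one_of_mem_Ico hk hr).2]
  unfold radiusFunction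
  refine ContinuousOn.mul (ContinuousOn.div (by fun_prop) ?_ ?_)
    (Real.continuous_exp.comp_continuousOn (ContinuousOn.div (by fun_prop) (by fun_prop) ?_))
  · exact ContinuousOn.rpow_const (by fun_prop) fun r hr => Or.inl (hne r hr).ne'
  · exact fun r hr => (Real.rpow_pos_of_pos (hne r hr) _).ne'
  · exact fun r hr => mul_ne_zero hk0 (hne r hr).ne'

theorem exists_radius {k : ℕ} (hk : 1 ≤ k) {α : ℝ} (hα0 : 0 ≤ α) (hα1 : α < 1) :
    ∃ r ∈ Ioo (0 : ℝ) 1, radiusFunction k α r = 1 := by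
  have hh : (1 / 2 : ℝ) ∈ Ico (0 : ℝ) 1 := by constructor <;> norm_num
  have hk0 : (0 : ℝ) < k := by exact_mod_cast (by omega : 0 < k)
  have hx := pow_lt_one_of_mem_Ico hk hh
  have h0 : radiusFunction k α 0 = 0 := by simp [radiusFunction]
  -- At `1/2` the majorant is at least `(1/2) * 1 * (1 + 1) = 1`, while `coveringRadius ≤ 1`.
  have h1 : 1 ≤ radiusFunction k α (1 / 2) := by
    have e := coveringRadius_mul_radiusFunction hk α hh
    have hR : coveringRadius k α ≤ 1 := by
      rw [coveringRadius, Real.exp_le_one_iff]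
      refine div_nonpos_of_nonpos_of_nonneg ?_ hk0.le
      have := mul_nonneg hα0 (Real.log_nonneg one_le_two)
      linarith
    have hS : 1 ≤ sharpMajorant k α (1 / 2) := by
      rw [sharpMajorant, growthExponent]
      set x := (1 / 2 : ℝ) ^ k
      have hx1 : 0 < 1 - x := by linarith [hx.2]
      have j1 : 1 ≤ Real.exp ((4 * (1 - α) * (x / (1 - x)) - 2 * α * Real.log (1 - x)) / k) := by
        rw [Real.one_le_exp_iff]
        refine div_nonneg ?_ hk0.le
        have := Real.log_nonpos hx1.le (by linarith [hx.1])
        have := div_nonneg hx.1 hx1.le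
        nlinarith [mul_nonneg (sub_nonneg.2 hα1.le) this]
      have j2 : 1 ≤ (1 + (1 - 2 * α) * x) / (1 - x) ^ 2 := by
        rw [le_div_iff₀ (by positivity)]
        nlinarith [hx.1, hx.2, mul_nonneg hx.1 (sub_nonneg.2 hα1.le),
          mul_nonneg hx.1 (sub_nonneg.2 hx.2.le)]
      nlinarith
    by_contra! hlt
    have := coveringRadius_pos k α
    nlinarith
  have hsub : Icc (0 : ℝ) (1 / 2) ⊆ Ico 0 1 := fun r hr => ⟨hr.1, by linarith [hr.2]⟩
  obtain ⟨r, hr, hr1⟩ := intermediate_value_Icc (by norm_num)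
    ((radiusFunction_continuousOn hk α).mono hsub) ⟨by rw [h0]; exact zero_le_one, h1⟩
  refine ⟨r, ⟨lt_of_le_of_ne hr.1 ?_, (hsub hr).2⟩, hr1⟩
  rintro rfl
  rw [h0] at hr1; exact zero_ne_one hr1

/-! ### Upper bound for the Bohr type majorant -/

theorem hasSum_log_geometric (k : ℕ) (c d : ℝ) {x : ℝ} (hx : x ∈ Ico (0 : ℝ) 1) :
    HasSum (fun n : ℕ => (c + d / (n + 1)) / k * x ^ (n + 1))
      ((c * (x / (1 - x)) - d * Real.log (1 - x)) / k) := by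
  have h1 := (hasSum_geometric_of_lt_one hx.1 hx.2).mul_left (c * x)
  have h2 := (Real.hasSum_pow_div_log_of_abs_lt_one
    (by rw [abs_of_nonneg hx.1]; exact hx.2)).mul_left d
  convert! (h1.add h2).div_const (k : ℝ) using 1
  · funext n; simp only [pow_succ]; ring
  · rw [div_eq_mul_inv x]; ring

theorem hasSum_one_add_linear (α : ℝ) {x : ℝ} (hx : x ∈ Ico (0 : ℝ) 1) :
    HasSum (fun n : ℕ => (1 + 2 * n * (1 - α)) * x ^ n)
      ((1 + (1 - 2 * α) * x) / (1 - x) ^ 2) := by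
  have h1 := hasSum_geometric_of_lt_one hx.1 hx.2
  have h2 := (hasSum_coe_mul_geometric_of_norm_lt_one (𝕜 := ℝ) (r := x)
    (by rw [Real.norm_of_nonneg hx.1]; exact hx.2)).mul_left (2 * (1 - α))
  have : 1 - x ≠ 0 := by linarith [hx.2]
  convert! h1.add h2 using 1
  · funext n; ring
  · field_simp; ring

namespace IsStarlikePair

variable {k : ℕ} {α : ℝ} {A B : ℂ → ℂ}

/-- Take `p = U - V` and `q = (U + V) / (U - V)`; the sign of `Re q` is that of `|U|² - |V|²`. -/
theorem exists_caratheodory (hα0 : 0 ≤ α) (hP : IsStarlikePair k α A B) :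
    ∃ p q : ℂ → ℂ, DifferentiableOn ℂ p (ball 0 1) ∧ p 0 = 1 ∧ DifferentiableOn ℂ q (ball 0 1) ∧
      q 0 = 1 ∧ (∀ x ∈ ball (0 : ℂ) 1, α < (p x).re) ∧ (∀ x ∈ ball (0 : ℂ) 1, 0 < (q x).re) ∧
      (∀ x ∈ ball (0 : ℂ) 1, 1 + k * (x * deriv A x) = p x * ((q x + 1) / 2)) ∧
      (∀ x ∈ ball (0 : ℂ) 1, k * (x * deriv B x) = p x * ((q x + -1) / 2)) := by
  have dA := hP.diffA.deriv isOpen_ball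
  have dB := hP.diffB.deriv isOpen_ball
  set U : ℂ → ℂ := fun x => 1 + k * (x * deriv A x) with hU
  set V : ℂ → ℂ := fun x => k * (x * deriv B x) with hV
  have dU : DifferentiableOn ℂ U (ball 0 1) :=
    ((differentiableOn_id.mul dA).const_mul _).const_add _
  have dV : DifferentiableOn ℂ V (ball 0 1) := (differentiableOn_id.mul dB).const_mul _
  have hre : ∀ x ∈ ball (0 : ℂ) 1, α < (U x - V x).re := hP.lt_re
  have hlt : ∀ x ∈ ball (0 : ℂ) 1, ‖V x‖ < ‖U x‖ := hP.norm_lt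
  have hne : ∀ x ∈ ball (0 : ℂ) 1, U x - V x ≠ 0 := fun x hx h => by
    have := hre x hx
    rw [h] at this; simp at this; linarith
  refine ⟨fun x => U x - V x, fun x => (U x + V x) / (U x - V x), dU.sub dV, by simp [hU, hV],
    (dU.add dV).div (dU.sub dV) hne, by simp [hU, hV], hre, ?_, ?_, ?_⟩
  · intro x hx
    have h1 : ‖V x‖ ^ 2 < ‖U x‖ ^ 2 := pow_lt_pow_left₀ (hlt x hx) (norm_nonneg _) two_ne_zero
    rw [← Complex.normSq_eq_norm_sq, ← Complex.normSq_eq_norm_sq, Complex.normSq_apply,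
      Complex.normSq_apply] at h1
    have h2 := Complex.normSq_pos.2 (hne x hx)
    rw [Complex.div_re, ← add_div]
    refine div_pos ?_ h2
    simp only [Complex.add_re, Complex.sub_re, Complex.add_im, Complex.sub_im]
    linarith
  · intro x hx
    have := hne x hx
    change U x = _
    field_simp; ring
  · intro x hx
    have := hne x hx
    change V x = _
    field_simp; ring

/-- Adding the two representations gives `U + V = p q`, the differential equation for `H = k (A +
B)`. -/
theorem coveringRadius_le (hk : 1 ≤ k) (hα0 : 0 ≤ α) (hα1 : α < 1) (hP : IsStarlikePair k α A B)
    {x : ℂ} (hx : x ∈ ball (0 : ℂ) 1) :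
    coveringRadius k α ≤ Real.exp ((A x).re + (B x).re) := by
  obtain ⟨p, q, -, -, hq, hq0, hpre, hqre, hU, hV⟩ := hP.exists_caratheodory hα0
  have hk0 : (0 : ℝ) < k := by exact_mod_cast (by omega : 0 < k)
  have h := neg_le_re_of_mul_deriv_eq hα0 hα1 (H := fun x => ((k : ℝ) : ℂ) * (A x + B x))
    ((hP.diffA.add hP.diffB).const_mul _) (by simp [hP.A_zero, hP.B_zero]) hq hq0 hpre hqre
    (fun y hy => by
      have hAy := (hP.diffA.differentiableAt (isOpen_ball.mem_nhds hy)).hasDerivAt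
      have hBy := (hP.diffB.differentiableAt (isOpen_ball.mem_nhds hy)).hasDerivAt
      have hAB : HasDerivAt (fun x => ((k : ℝ) : ℂ) * (A x + B x))
        (((k : ℝ) : ℂ) * (deriv A y + deriv B y)) y := (hAy.add hBy).const_mul _
      rw [hAB.deriv]
      push_cast
      linear_combination hU y hy + hV y hy) hx
  rw [Complex.re_ofReal_mul, Complex.add_re] at h
  rw [coveringRadius, Real.exp_le_exp, div_le_iff₀ hk0]
  linarith

/-- The coefficient bounds `1 + 2n (1 - α)` are the Taylor coefficients of the right-hand side. -/
theorem norm_one_add_le (hα0 : 0 ≤ α) (hα1 : α < 1) (hP : IsStarlikePair k α A B)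
    {x : ℂ} (hx : x ∈ ball (0 : ℂ) 1) :
    ‖1 + k * (x * deriv A x)‖ ≤ (1 + (1 - 2 * α) * ‖x‖) / (1 - ‖x‖) ^ 2 := by
  obtain ⟨p, q, hp, hp0, hq, hq0, hpre, hqre, hU, -⟩ := hP.exists_caratheodory hα0
  have hu := hasDiskSeries_taylor (hp.mul ((hq.add_const 1).div_const 2))
  have hb := norm_coeff_mul_half_add_le hα1 hp hp0 hq hq0 hpre hqre hu
  rw [hU x hx]
  have hs := hu x hx
  refine hs.norm_le_of_bounded
    (hasSum_one_add_linear α ⟨norm_nonneg x, by simpa using hx⟩) fun n => ?_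
  rw [norm_mul, norm_pow]
  exact mul_le_mul_of_nonneg_right (hb n) (by positivity)

theorem norm_coeff_A_le (hk : 1 ≤ k) (hα0 : 0 ≤ α) (hα1 : α < 1) (hP : IsStarlikePair k α A B)
    {a : ℕ → ℂ} (hA : HasDiskSeries A a) (n : ℕ) :
    ‖a (n + 1)‖ ≤ (2 * (1 - α) + 1 / (n + 1)) / k := by
  obtain ⟨p, q, hp, hp0, hq, hq0, hpre, hqre, hU, -⟩ := hP.exists_caratheodory hα0
  have hk0 : (0 : ℝ) < k := by exact_mod_cast (by omega : 0 < k)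
  have hu : HasDiskSeries (fun x => p x * ((q x + 1) / 2))
      (fun n => (if n = 0 then 1 else 0) + k * (n * a n)) := by
    intro x hx
    simp only
    rw [← hU x hx]
    have h1 : HasSum (fun n : ℕ => (if n = 0 then (1 : ℂ) else 0) * x ^ n) 1 := by
      have := hasSum_single (f := fun n : ℕ => (if n = 0 then (1 : ℂ) else 0) * x ^ n) 0
        (fun n hn => by simp [hn])
      simpa using this
    refine (h1.add ((hA.mul_deriv x hx).mul_left (k : ℂ))).congr_fun fun n => ?_
    ring
  have hb := norm_coeff_mul_half_add_le hα1 hp hp0 hq hq0 hpre hqre hu (n + 1)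
  simp only [Nat.succ_ne_zero, if_false, zero_add, norm_mul, Complex.norm_natCast] at hb
  have hn : (0 : ℝ) < n + 1 := by positivity
  rw [le_div_iff₀ hk0]
  refine le_of_mul_le_mul_right ?_ hn
  rw [add_mul, div_mul_cancel₀ _ hn.ne']
  push_cast at hb
  linarith

theorem norm_coeff_B_le (hk : 1 ≤ k) (hα0 : 0 ≤ α) (hα1 : α < 1) (hP : IsStarlikePair k α A B)
    {b : ℕ → ℂ} (hB : HasDiskSeries B b) (n : ℕ) :
    ‖b (n + 1)‖ ≤ (2 * (1 - α) + (2 * α - 1) / (n + 1)) / k := by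
  obtain ⟨p, q, hp, hp0, hq, hq0, hpre, hqre, -, hV⟩ := hP.exists_caratheodory hα0
  have hk0 : (0 : ℝ) < k := by exact_mod_cast (by omega : 0 < k)
  have hu : HasDiskSeries (fun x => p x * ((q x + -1) / 2)) (fun n => k * (n * b n)) := by
    intro x hx
    simp only
    rw [← hV x hx]
    refine ((hB.mul_deriv x hx).mul_left (k : ℂ)).congr_fun fun n => ?_
    ring
  have hb := norm_coeff_mul_half_sub_le hα1 hp hp0 hq hq0 hpre hqre hu n
  simp only [norm_mul, Complex.norm_natCast] at hb
  have hn : (0 : ℝ) < n + 1 := by positivity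
  rw [le_div_iff₀ hk0]
  refine le_of_mul_le_mul_right ?_ hn
  rw [add_mul, div_mul_cancel₀ _ hn.ne']
  push_cast at hb
  linarith

end IsStarlikePair

theorem HasDiskSeries.norm_le_of_coeff_le {k : ℕ} {c d : ℝ} {A : ℂ → ℂ} {a : ℕ → ℂ}
    (hA : HasDiskSeries A a) (hA0 : A 0 = 0)
    (ha : ∀ n, ‖a (n + 1)‖ ≤ (c + d / (n + 1)) / k) {x : ℂ} (hx : x ∈ ball (0 : ℂ) 1) :
    ‖A x‖ ≤ (c * (‖x‖ / (1 - ‖x‖)) - d * Real.log (1 - ‖x‖)) / k := by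
  have h1 := hA x hx
  rw [← hasSum_nat_add_iff' 1] at h1
  simp only [Finset.range_one, Finset.sum_singleton, ← hA.apply_zero, hA0, zero_mul,
    sub_zero] at h1
  refine h1.norm_le_of_bounded
    (hasSum_log_geometric k c d ⟨norm_nonneg x, by simpa using hx⟩) fun n => ?_
  rw [norm_mul, norm_pow]
  exact mul_le_mul_of_nonneg_right (ha n) (by positivity)

/-- The bounds for `a` and `b` add up to the coefficients of `growthExponent`. One series therefore
controls both the Bohr sum and `log |f / z|`. -/
theorem bohrMajorant_le {k : ℕ} (hk : 1 ≤ k) {α : ℝ} (hα0 : 0 ≤ α) (hα1 : α < 1)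
    {A B f : ℂ → ℂ} {a b : ℕ → ℂ} (hP : IsStarlikePair k α A B) (hf : HasExponents k A B f)
    (hA : HasDiskSeries A (fun n => if n = 0 then 0 else a (n * k)))
    (hB : HasDiskSeries B (fun n => if n = 0 then 0 else b (n * k))) (θ : ℝ) {z : ℂ}
    (hz : z ∈ ball (0 : ℂ) 1) :
    Summable (bohrTerm k a b θ z) ∧ bohrMajorant k f a b θ z ≤ sharpMajorant k α ‖z‖ := by
  have hx := pow_mem_ball_zero_one hk hz
  have hr : ‖z‖ ^ k ∈ Ico (0 : ℝ) 1 :=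
    pow_lt_one_of_mem_Ico hk ⟨norm_nonneg z, by simpa using hz⟩
  have hA1 := hP.norm_coeff_A_le hk hα0 hα1 hA
  have hB1 := hP.norm_coeff_B_le hk hα0 hα1 hB
  have hterm : ∀ n, bohrTerm k a b θ z n ≤
      (4 * (1 - α) + 2 * α / (n + 1)) / k * (‖z‖ ^ k) ^ (n + 1) := by
    intro n
    rw [bohrTerm, ← pow_mul, mul_comm k]
    refine mul_le_mul_of_nonneg_right ?_ (by positivity)
    refine (norm_add_le _ _).trans ?_
    rw [norm_mul, Complex.norm_exp_ofReal_mul_I, one_mul]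
    have h1 := hA1 n
    have h2 := hB1 n
    simp only [Nat.succ_ne_zero, if_false] at h1 h2
    refine (add_le_add h1 h2).trans_eq ?_
    ring
  have hnn : ∀ n, 0 ≤ bohrTerm k a b θ z n := fun n => by rw [bohrTerm]; positivity
  have hsum := hasSum_log_geometric k (4 * (1 - α)) (2 * α) hr
  have hS : Summable (bohrTerm k a b θ z) := Summable.of_nonneg_of_le hnn hterm hsum.summable
  refine ⟨hS, ?_⟩
  have ht : ∑' n, bohrTerm k a b θ z n ≤ growthExponent k α (‖z‖ ^ k) :=
    hasSum_le hterm hS.hasSum hsum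
  have hnA := hA.norm_le_of_coeff_le hP.A_zero hA1 hx
  have hnB := hB.norm_le_of_coeff_le hP.B_zero hB1 hx
  have hU := hP.norm_one_add_le hα0 hα1 hx
  rw [norm_pow] at hnA hnB hU
  have hAB : (A (z ^ k)).re + (B (z ^ k)).re ≤ growthExponent k α (‖z‖ ^ k) := by
    have h1 := add_le_add ((Complex.re_le_norm _).trans hnA) ((Complex.re_le_norm _).trans hnB)
    refine h1.trans_eq ?_
    rw [growthExponent]; ring
  rw [bohrMajorant, hf.mul_wirtingerZ hk hP.diffA hP.diffB hz, norm_mul, hf.norm_eq hz,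
    sharpMajorant, mul_add, mul_one, add_comm]
  gcongr

/-! ### The image and its boundary -/

/-- An injective map of the disk that is open there has a continuous inverse. -/
theorem tendsto_of_tendsto_image {f : ℂ → ℂ} (hinj : InjOn f (ball 0 1))
    (hopen : ∀ z ∈ ball (0 : ℂ) 1, map f (𝓝 z) = 𝓝 (f z)) {ι : Type*} {l : Filter ι} {u : ι → ℂ}
    (hu : ∀ᶠ i in l, u i ∈ ball (0 : ℂ) 1) {z : ℂ} (hz : z ∈ ball (0 : ℂ) 1)
    (h : Tendsto (fun i => f (u i)) l (𝓝 (f z))) : Tendsto u l (𝓝 z) := by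
  intro N hN
  have h1 : f '' (N ∩ ball 0 1) ∈ 𝓝 (f z) := by
    rw [← hopen z hz]
    exact image_mem_map (inter_mem hN (isOpen_ball.mem_nhds hz))
  have h2 : ∀ᶠ i in l, f (u i) ∈ f '' (N ∩ ball 0 1) := h h1
  change ∀ᶠ i in l, u i ∈ N
  filter_upwards [hu, h2] with i hi ⟨w, hw, hwi⟩
  rw [← hinj hw.2 hi hwi]
  exact hw.1

section

variable {k : ℕ} {α : ℝ} {A B f : ℂ → ℂ}

theorem IsStarlikePair.map_nhds (hk : 1 ≤ k) (hP : IsStarlikePair k α A B)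
    (hf : HasExponents k A B f) {z : ℂ} (hz : z ∈ ball (0 : ℂ) 1) : map f (𝓝 z) = 𝓝 (f z) := by
  refine (hf.hasStrictFDerivAt hk hP.diffA hP.diffB hz).map_nhds_eq_of_surj
    (wirtingerMap_surjective ?_)
  have hzk : z ^ k = z * z ^ (k - 1) := by rw [← pow_succ', Nat.sub_add_cancel hk]
  have hx := hP.norm_lt _ (pow_mem_ball_zero_one hk hz)
  have hEA : 0 < ‖Complex.exp (A (z ^ k))‖ := norm_pos_iff.2 (Complex.exp_ne_zero _)
  have hEB : 0 < ‖Complex.exp (B (z ^ k))‖ := norm_pos_iff.2 (Complex.exp_ne_zero _)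
  calc _ = ‖Complex.exp (A (z ^ k))‖ * ‖Complex.exp (B (z ^ k))‖ *
        ‖k * (z ^ k * deriv B (z ^ k))‖ := by
        have : ‖z ^ k‖ = ‖z‖ * ‖z ^ (k - 1)‖ := by rw [hzk, norm_mul]
        simp only [norm_mul, RCLike.norm_conj, this]
        ring
    _ < ‖Complex.exp (A (z ^ k))‖ * ‖Complex.exp (B (z ^ k))‖ *
        ‖1 + k * (z ^ k * deriv A (z ^ k))‖ := by gcongr
    _ = _ := by rw [norm_mul (_ * _) (1 + _), norm_mul (Complex.exp _), RCLike.norm_conj]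

theorem IsStarlikePair.isOpen_image (hk : 1 ≤ k) (hP : IsStarlikePair k α A B)
    (hf : HasExponents k A B f) : IsOpen (f '' ball 0 1) := by
  rw [isOpen_iff_mem_nhds]
  rintro _ ⟨z, hz, rfl⟩
  rw [← hP.map_nhds hk hf hz]
  exact image_mem_map (isOpen_ball.mem_nhds hz)

/-- Ensures a nonempty frontier; `infDist` to the empty set would be `0`. For a surjective `f` the
continuous inverse maps the disk of radius `2` into a compact part of the unit disk, so `|f| > 2` on
some circle. The maximum principle for `exp (-(A + B))`, which is `1` at the origin, then fails. -/
theorem IsStarlikePair.image_ne_univ (hk : 1 ≤ k) (hP : IsStarlikePair k α A B)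
    (hf : HasExponents k A B f) (hinj : InjOn f (ball 0 1)) : f '' ball 0 1 ≠ univ := by
  intro huniv
  have hsurj : SurjOn f (ball 0 1) univ := huniv.ge
  set g := Function.invFunOn f (ball 0 1)
  have hg : ∀ w, g w ∈ ball (0 : ℂ) 1 := fun w => Function.invFunOn_mem (hsurj (mem_univ w))
  have hfg : ∀ w, f (g w) = w := fun w => Function.invFunOn_eq (hsurj (mem_univ w))
  have hgc : Continuous g := by
    rw [continuous_iff_continuousAt]
    intro w
    refine tendsto_of_tendsto_image hinj (fun z hz => hP.map_nhds hk hf hz)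
      (Eventually.of_forall hg) (hg w) ?_
    simp only [hfg]
    exact tendsto_id
  obtain ⟨w₀, -, hmax⟩ := (isCompact_closedBall (0 : ℂ) 2).exists_isMaxOn ⟨0, by simp⟩
    (hgc.norm.continuousOn)
  have hw₀ : ‖g w₀‖ < 1 := by simpa using hg w₀
  obtain ⟨r, hr0, hr1⟩ := exists_between hw₀
  have hrpos : 0 < r := (norm_nonneg _).trans_lt hr0
  have hbig : ∀ z : ℂ, ‖z‖ = r → 2 < ‖f z‖ := by
    intro z hz
    have hzb : z ∈ ball (0 : ℂ) 1 := by simpa [hz] using hr1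
    by_contra! hle
    have h1 : ‖g (f z)‖ ≤ ‖g w₀‖ := hmax (by simpa using hle)
    have h2 : g (f z) = z := hinj (hg _) hzb (hfg _)
    rw [h2, hz] at h1
    linarith
  have hsub : closedBall (0 : ℂ) r ⊆ ball 0 1 := closedBall_subset_ball hr1
  have hpow : DifferentiableOn ℂ (fun z : ℂ => z ^ k) (ball 0 1) :=
    (differentiable_pow k).differentiableOn
  have hmaps : MapsTo (fun z : ℂ => z ^ k) (ball 0 1) (ball 0 1) :=
    fun z hz => pow_mem_ball_zero_one hk hz
  have hd : DiffContOnCl ℂ (fun z => Complex.exp (-(A (z ^ k) + B (z ^ k)))) (ball 0 r) :=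
    DifferentiableOn.diffContOnCl_ball (U := ball 0 1)
      (((hP.diffA.comp hpow hmaps).add (hP.diffB.comp hpow hmaps)).neg.cexp) hsub
  have h := Complex.norm_le_of_forall_mem_frontier_norm_le (C := 1 / 2) isBounded_ball hd
    (fun z hz => by
      rw [frontier_ball _ hrpos.ne'] at hz
      have hzr : ‖z‖ = r := by simpa using hz
      have hzb : z ∈ ball (0 : ℂ) 1 := by simpa [hzr] using hr1
      have h1 := hbig z hzr
      rw [hf.norm_eq hzb, hzr] at h1
      rw [Complex.norm_exp, Complex.neg_re, Complex.add_re, Real.exp_neg, one_div]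
      refine inv_anti₀ two_pos (h1.le.trans ?_)
      exact mul_le_of_le_one_left (Real.exp_pos _).le hr1.le)
    (subset_closure (mem_ball_self hrpos))
  rw [zero_pow (by omega), hP.A_zero, hP.B_zero] at h
  norm_num at h

theorem IsStarlikePair.coveringRadius_le_boundaryDist (hk : 1 ≤ k) (hα0 : 0 ≤ α) (hα1 : α < 1)
    (hP : IsStarlikePair k α A B) (hf : HasExponents k A B f) (hinj : InjOn f (ball 0 1)) :
    coveringRadius k α ≤ boundaryDist f := by
  rw [boundaryDist, unitDisk, hf.map_zero]
  have hne : (frontier (f '' ball 0 1)).Nonempty :=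
    nonempty_frontier_iff.2 ⟨⟨f 0, 0, by simp, rfl⟩, hP.image_ne_univ hk hf hinj⟩
  rw [le_infDist hne]
  intro w hw
  rw [(hP.isOpen_image hk hf).frontier_eq] at hw
  obtain ⟨v, hv, hvw⟩ := mem_closure_iff_seq_limit.1 hw.1
  choose u hu huv using hv
  have huc : ∀ n, u n ∈ closedBall (0 : ℂ) 1 := fun n => ball_subset_closedBall (hu n)
  obtain ⟨ζ, hζ, φ, hφ, hlim⟩ := (isCompact_closedBall (0 : ℂ) 1).tendsto_subseq huc
  have hfw : Tendsto (fun n => f (u (φ n))) atTop (𝓝 w) := by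
    simp only [huv]
    exact hvw.comp hφ.tendsto_atTop
  -- A limit point inside the disk would put `w` in the open image, away from its frontier.
  have hζ1 : ‖ζ‖ = 1 := by
    refine le_antisymm (by simpa using hζ) (not_lt.1 fun hlt => hw.2 ?_)
    have hζb : ζ ∈ ball (0 : ℂ) 1 := by simpa using hlt
    have h1 : Tendsto (fun n => f (u (φ n))) atTop (𝓝 (f ζ)) :=
      (hf.hasStrictFDerivAt hk hP.diffA hP.diffB hζb).continuousAt.tendsto.comp hlim
    exact ⟨ζ, hζb, tendsto_nhds_unique h1 hfw⟩
  rw [dist_zero_left]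
  have hl : Tendsto (fun n => ‖u (φ n)‖ * coveringRadius k α) atTop
      (𝓝 (‖ζ‖ * coveringRadius k α)) := hlim.norm.mul_const _
  rw [hζ1, one_mul] at hl
  refine le_of_tendsto_of_tendsto' hl hfw.norm fun n => ?_
  rw [hf.norm_eq (hu _)]
  gcongr
  exact hP.coveringRadius_le hk hα0 hα1 (pow_mem_ball_zero_one hk (hu _))

/-- A limit of values along a path to the unit circle is not itself a value: continuity of the
inverse would make the path converge inside the disk. -/
theorem IsStarlikePair.boundaryDist_le (hk : 1 ≤ k) (hP : IsStarlikePair k α A B)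
    (hf : HasExponents k A B f) (hinj : InjOn f (ball 0 1)) {ι : Type*} {l : Filter ι} [l.NeBot]
    {u : ι → ℂ} (hu : ∀ᶠ i in l, u i ∈ ball (0 : ℂ) 1) {ζ w : ℂ} (hζ : ‖ζ‖ = 1)
    (huζ : Tendsto u l (𝓝 ζ)) (hfw : Tendsto (fun i => f (u i)) l (𝓝 w)) :
    boundaryDist f ≤ ‖w‖ := by
  rw [boundaryDist, unitDisk, hf.map_zero, ← dist_zero_left]
  refine infDist_le_dist_of_mem ?_
  rw [(hP.isOpen_image hk hf).frontier_eq]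
  refine ⟨mem_closure_of_tendsto hfw (hu.mono fun i hi => ⟨_, hi, rfl⟩), ?_⟩
  rintro ⟨z, hz, rfl⟩
  have h1 := tendsto_of_tendsto_image hinj (fun z hz => hP.map_nhds hk hf hz) hu hz hfw
  have h2 := tendsto_nhds_unique h1 huζ
  rw [← h2] at hζ
  simp [hζ] at hz

end

/-! ### Univalence of the extremal mapping in triangle coordinates -/

section Injectivity

variable {β : ℝ}

/-- The logarithm of the modulus of the extremal mapping in triangle coordinates: `y` and `y - 1`
are seen under the angles `χ` and `χ + δ`. -/
noncomputable def triangleModulus (β χ δ : ℝ) : ℝ :=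
  Real.log (Real.sin χ) - Real.log (Real.sin δ)
    - β * (Real.log (Real.sin (χ + δ)) - Real.log (Real.sin δ))
    + 2 * (1 + β) * (Real.sin (χ + δ) * Real.cos χ / Real.sin δ)

/-- Here `a, b` are sine and cosine of `χ`, `s, t` of `δ`, and `p, r` of `χ + δ`. The left side is
the derivative of `triangleModulus` when `δ' = -(1 + β)`; on the right the only factor of unclear
sign is `p b + r a = sin (2χ + δ)`. -/
theorem triangle_identity {a b s t p r : ℝ} (ha : 0 < a) (hs : 0 < s) (hp : 0 < p)
    (hab : a ^ 2 + b ^ 2 = 1) (hst : s ^ 2 + t ^ 2 = 1) (hpe : p = a * t + b * s)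
    (hre : r = b * t - a * s) :
    b / a - -(1 + β) * t / s - β * (-β * r / p - -(1 + β) * t / s)
      + 2 * (1 + β) * (((-β * r * b + p * -a) * s - p * b * (-(1 + β) * t)) / s ^ 2)
      = (p * b + r * a) * ((β * a + t * p) ^ 2 + p ^ 2 * s ^ 2) / (a * s ^ 2 * p) := by
  field_simp
  grind

/-- The curve `δ + (1 + β) χ = c` is a level curve of the argument of the mapping. -/
theorem strictMonoOn_triangleModulus (c : ℝ) {χ₁ χ₂ : ℝ} (h1 : 0 < χ₁)
    (hδ : 0 < c - (1 + β) * χ₂) (hδ1 : 0 < c - (1 + β) * χ₁)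
    (hπ : 2 * χ₁ + (c - (1 + β) * χ₁) < Real.pi) (hπ2 : 2 * χ₂ + (c - (1 + β) * χ₂) < Real.pi) :
    StrictMonoOn (fun χ => triangleModulus β χ (c - (1 + β) * χ)) (Icc χ₁ χ₂) := by
  -- The constraints are affine in `χ`, so they hold between the endpoints.
  have hmem : ∀ χ ∈ Icc χ₁ χ₂, 0 < χ ∧ 0 < c - (1 + β) * χ ∧
      2 * χ + (c - (1 + β) * χ) < Real.pi := by
    intro χ hχ
    refine ⟨h1.trans_le hχ.1, ?_, ?_⟩
    · rcases le_total 0 (1 + β) with hb | hb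
      · nlinarith [hχ.2]
      · nlinarith [hχ.1]
    · rcases le_total 0 (2 - (1 + β)) with hb | hb
      · nlinarith [hχ.2]
      · nlinarith [hχ.1]
  have hd : ∀ χ ∈ Icc χ₁ χ₂, ∃ m, 0 < m ∧
      HasDerivAt (fun χ => triangleModulus β χ (c - (1 + β) * χ)) m χ := by
    intro χ hχ
    obtain ⟨k1, k2, k3⟩ := hmem χ hχ
    have dδ : HasDerivAt (fun χ : ℝ => c - (1 + β) * χ) (-(1 + β)) χ := by
      simpa using ((hasDerivAt_id χ).const_mul (1 + β)).const_sub c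
    have dS : HasDerivAt (fun χ : ℝ => χ + (c - (1 + β) * χ)) (-β) χ := by
      convert! (hasDerivAt_id χ).add dδ using 1; ring
    have ha : 0 < Real.sin χ := Real.sin_pos_of_pos_of_lt_pi k1 (by linarith)
    have hs : 0 < Real.sin (c - (1 + β) * χ) := Real.sin_pos_of_pos_of_lt_pi k2 (by linarith)
    have hp : 0 < Real.sin (χ + (c - (1 + β) * χ)) :=
      Real.sin_pos_of_pos_of_lt_pi (by linarith) (by linarith)
    have hq : 0 < Real.sin ((χ + (c - (1 + β) * χ)) + χ) :=
      Real.sin_pos_of_pos_of_lt_pi (by linarith) (by linarith)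
    have e1 := (Real.hasDerivAt_sin χ).log ha.ne'
    have e2 := dδ.sin.log hs.ne'
    have e3 := dS.sin.log hp.ne'
    have e4 := (dS.sin.mul (Real.hasDerivAt_cos χ)).div dδ.sin hs.ne'
    have e := ((e1.sub e2).sub ((e3.sub e2).const_mul β)).add (e4.const_mul (2 * (1 + β)))
    rw [Real.sin_add] at hq
    have hid := triangle_identity (β := β) ha hs hp (Real.sin_sq_add_cos_sq χ)
      (Real.sin_sq_add_cos_sq _) (Real.sin_add χ _)
      (Real.cos_add χ _)
    refine ⟨_, lt_of_lt_of_eq ?_ hid.symm, e.congr_deriv ?_⟩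
    · have : 0 < (Real.sin (χ + (c - (1 + β) * χ))) ^ 2 * (Real.sin (c - (1 + β) * χ)) ^ 2 := by
        positivity
      refine div_pos (mul_pos hq ?_) (by positivity)
      positivity
    · simp only [Pi.mul_apply]
      ring
  refine strictMonoOn_of_deriv_pos (convex_Icc _ _) (fun χ hχ => ?_) fun χ hχ => ?_
  · obtain ⟨m, -, hm⟩ := hd χ hχ
    exact hm.continuousAt.continuousWithinAt
  · rw [interior_Icc] at hχ
    obtain ⟨m, hm0, hm⟩ := hd χ (Ioo_subset_Icc_self hχ)
    rwa [hm.deriv]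

/-- Triangle coordinates of a point of the quarter plane `Re y > 1/2`, `Im y > 0`. -/
theorem exists_triangle_coordinates {y : ℂ} (hre : 1 / 2 < y.re) (him : 0 < y.im) :
    ∃ χ δ : ℝ, 0 < χ ∧ 0 < δ ∧ 2 * χ + δ < Real.pi ∧
      y = (Real.sin (χ + δ) / Real.sin δ : ℝ) * Complex.exp (χ * Complex.I) ∧
      y - 1 = (Real.sin χ / Real.sin δ : ℝ) * Complex.exp ((χ + δ : ℝ) * Complex.I) := by
  have hpi := Real.pi_pos
  have hy0 : y ≠ 0 := fun h => by rw [h] at him; simp at him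
  have hχ0 : 0 < y.arg := by
    refine lt_of_le_of_ne (Complex.arg_nonneg_iff.2 him.le) fun h => ?_
    have := (Complex.arg_eq_zero_iff.1 h.symm).2
    linarith
  have hχ1 : y.arg < Real.pi / 2 := by
    have := Complex.abs_arg_lt_pi_div_two_iff.2 (Or.inl (show 0 < y.re by linarith))
    exact (abs_lt.1 this).2
  set v := (y - 1) / y with hv
  have hns : 0 < Complex.normSq y := Complex.normSq_pos.2 hy0
  have hvim : 0 < v.im := by
    have : v.im = y.im / Complex.normSq y := by
      rw [hv, Complex.div_im, Complex.sub_re, Complex.sub_im, Complex.one_re, Complex.one_im]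
      field_simp; ring
    rw [this]; positivity
  have hδ0 : 0 < v.arg := by
    refine lt_of_le_of_ne (Complex.arg_nonneg_iff.2 hvim.le) fun h => ?_
    have := (Complex.arg_eq_zero_iff.1 h.symm).2
    linarith
  have hδ1 : v.arg < Real.pi := by
    refine lt_of_le_of_ne (Complex.arg_le_pi v) fun h => ?_
    have := (Complex.arg_eq_pi_iff.1 h).2
    linarith
  have hv0 : v ≠ 0 := fun h => by rw [h] at hvim; simp at hvim
  have hR : 0 < ‖y‖ := norm_pos_iff.2 hy0
  have hM : 0 < ‖v‖ := norm_pos_iff.2 hv0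
  have ey : y = ‖y‖ * Complex.exp (y.arg * Complex.I) := (Complex.norm_mul_exp_arg_mul_I y).symm
  have ev : v = ‖v‖ * Complex.exp (v.arg * Complex.I) := (Complex.norm_mul_exp_arg_mul_I v).symm
  have eyv : y - 1 = y * v := by rw [hv]; field_simp
  set χ := y.arg
  set δ := v.arg
  set R := ‖y‖
  set M := ‖v‖
  have e1 : y - 1 = (R * M : ℝ) * Complex.exp ((χ + δ : ℝ) * Complex.I) := by
    rw [eyv]; nth_rewrite 1 [ey]; nth_rewrite 1 [ev]
    push_cast; rw [add_mul, Complex.exp_add]; ring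
  have e2 : y * (y - 1) = (R * (R * M) : ℝ) * Complex.exp ((χ + (χ + δ) : ℝ) * Complex.I) := by
    rw [e1]; nth_rewrite 1 [ey]
    push_cast; rw [add_mul (χ : ℂ) (χ + δ), Complex.exp_add]; ring
  have i0 : ∀ s t : ℝ, ((s : ℂ) * Complex.exp (t * Complex.I)).im = s * Real.sin t := fun s t => by
    rw [Complex.im_ofReal_mul, Complex.exp_ofReal_mul_I_im]
  have r0 : ∀ s t : ℝ, ((s : ℂ) * Complex.exp (t * Complex.I)).re = s * Real.cos t := fun s t => by
    rw [Complex.re_ofReal_mul, Complex.exp_ofReal_mul_I_re]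
  have i1 := congrArg Complex.im e1
  have i2 := congrArg Complex.im e2
  have i3 := congrArg Complex.im ey
  have i4 := congrArg Complex.re ey
  have i5 := congrArg Complex.re e1
  rw [i0] at i1 i2 i3
  rw [r0] at i4 i5
  simp only [Complex.sub_im, Complex.one_im, sub_zero, Complex.mul_im, Complex.sub_re,
    Complex.one_re] at i1 i2 i5
  have s1 : 0 < Real.sin (χ + δ) := by
    by_contra! hle
    have := mul_nonpos_of_nonneg_of_nonpos (mul_pos hR hM).le hle
    linarith
  have l1 : χ + δ < Real.pi := by
    by_contra! hle
    have : 0 ≤ Real.sin (χ + δ - Real.pi) :=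
      Real.sin_nonneg_of_nonneg_of_le_pi (by linarith) (by linarith)
    rw [Real.sin_sub_pi] at this; linarith
  -- The condition `Re y > 1/2` enters here: `Im (y (y - 1)) = Im y * (2 Re y - 1)`.
  have s2 : 0 < Real.sin (χ + (χ + δ)) := by
    by_contra! hle
    have h1 := mul_nonpos_of_nonneg_of_nonpos (mul_pos hR (mul_pos hR hM)).le hle
    have h2 : 0 < y.im * (2 * y.re - 1) := mul_pos him (by linarith)
    nlinarith
  have l2 : χ + (χ + δ) < Real.pi := by
    by_contra! hle
    have : 0 ≤ Real.sin (χ + (χ + δ) - Real.pi) :=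
      Real.sin_nonneg_of_nonneg_of_le_pi (by linarith) (by linarith)
    rw [Real.sin_sub_pi] at this; linarith
  have sδ : 0 < Real.sin δ := Real.sin_pos_of_pos_of_lt_pi hδ0 hδ1
  have f1 : R * Real.cos χ - R * M * Real.cos (χ + δ) = 1 := by linarith
  have f2 : R * Real.sin χ - R * M * Real.sin (χ + δ) = 0 := by linarith
  have g1 : R * Real.sin δ = Real.sin (χ + δ) := by
    have : Real.sin δ = Real.sin (χ + δ) * Real.cos χ - Real.cos (χ + δ) * Real.sin χ := by
      rw [← Real.sin_sub]; congr 1; ring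
    rw [this]; linear_combination Real.sin (χ + δ) * f1 - Real.cos (χ + δ) * f2
  have g2 : R * M * Real.sin δ = Real.sin χ := by
    have : Real.sin δ = Real.sin (χ + δ) * Real.cos χ - Real.cos (χ + δ) * Real.sin χ := by
      rw [← Real.sin_sub]; congr 1; ring
    rw [this]; linear_combination Real.sin χ * f1 - Real.cos χ * f2
  refine ⟨χ, δ, hχ0, hδ0, by linarith, ?_, ?_⟩
  · rw [← g1, mul_div_cancel_right₀ _ sδ.ne']; exact ey
  · rw [← g2, mul_div_cancel_right₀ _ sδ.ne']; exact e1

/-- The extremal mapping in the variable `y = 1 / (1 - x)`. -/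
noncomputable def halfPlaneMap (β : ℝ) (y : ℂ) : ℂ :=
  (y - 1) * Complex.exp (-β * conj (Complex.log y) + 2 * (1 + β) * (y.re - 1))

theorem halfPlaneMap_conj {y : ℂ} (hre : 1 / 2 < y.re) :
    halfPlaneMap β (conj y) = conj (halfPlaneMap β y) := by
  have : y.arg ≠ Real.pi := by
    rw [Ne, Complex.arg_eq_pi_iff]; rintro ⟨h, -⟩; linarith
  simp only [halfPlaneMap, Complex.log_conj y this, map_mul, ← Complex.exp_conj, map_sub, map_one,
    map_add, map_neg, Complex.conj_ofReal, Complex.conj_conj, Complex.conj_re, map_ofNat]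

theorem halfPlaneMap_eq_exp {y : ℂ} {χ δ : ℝ} (hχ : 0 < χ) (hδ : 0 < δ)
    (hπ : 2 * χ + δ < Real.pi)
    (hy : y = (Real.sin (χ + δ) / Real.sin δ : ℝ) * Complex.exp (χ * Complex.I))
    (hy1 : y - 1 = (Real.sin χ / Real.sin δ : ℝ) * Complex.exp ((χ + δ : ℝ) * Complex.I)) :
    halfPlaneMap β y = Complex.exp ((triangleModulus β χ δ - 2 * (1 + β) : ℝ)
      + (δ + (1 + β) * χ : ℝ) * Complex.I) := by
  have s1 : 0 < Real.sin χ := Real.sin_pos_of_pos_of_lt_pi hχ (by linarith)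
  have s2 : 0 < Real.sin δ := Real.sin_pos_of_pos_of_lt_pi hδ (by linarith)
  have s3 : 0 < Real.sin (χ + δ) := Real.sin_pos_of_pos_of_lt_pi (by linarith) (by linarith)
  have hlog : Complex.log y = (Real.log (Real.sin (χ + δ) / Real.sin δ) : ℝ) + χ * Complex.I := by
    rw [hy, Complex.log_ofReal_mul (by positivity) (Complex.exp_ne_zero _), Complex.log_exp]
    · simp; linarith
    · simp; linarith
  have hre : y.re = Real.sin (χ + δ) * Real.cos χ / Real.sin δ := by
    rw [hy, Complex.re_ofReal_mul, Complex.exp_ofReal_mul_I_re]; ring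
  have hexp : ((Real.sin χ / Real.sin δ : ℝ) : ℂ)
      = Complex.exp (Real.log (Real.sin χ / Real.sin δ) : ℝ) := by
    rw [← Complex.ofReal_exp, Real.exp_log (by positivity)]
  rw [halfPlaneMap, hy1, hexp, hlog, hre, ← Complex.exp_add, ← Complex.exp_add,
    Real.log_div s1.ne' s2.ne', Real.log_div s3.ne' s2.ne', triangleModulus]
  congr 1
  simp only [map_add, map_mul, Complex.conj_ofReal, Complex.conj_I]
  push_cast
  ring

/-- The argument `δ + (1 + β) χ` lies in `(0, π)` because `0 < 1 + β ≤ 2` and `2χ + δ < π`. -/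
theorem halfPlaneMap_im_pos (hβ : -1 < β) (hβ1 : β ≤ 1) {y : ℂ} (hre : 1 / 2 < y.re)
    (him : 0 < y.im) : 0 < (halfPlaneMap β y).im := by
  obtain ⟨χ, δ, hχ, hδ, hπ, hy, hy1⟩ := exists_triangle_coordinates hre him
  rw [halfPlaneMap_eq_exp hχ hδ hπ hy hy1, Complex.exp_add, ← Complex.ofReal_exp,
    Complex.im_ofReal_mul, Complex.exp_ofReal_mul_I_im]
  refine mul_pos (Real.exp_pos _) (Real.sin_pos_of_pos_of_lt_pi ?_ ?_) <;> nlinarith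

/-- Arguments in `(0, π)` are determined without ambiguity, so equal values put both points on one
level curve; there equal moduli force equal `χ`. -/
theorem halfPlaneMap_injective_aux (hβ : -1 < β) (hβ1 : β ≤ 1) {y w : ℂ} (hy : 1 / 2 < y.re)
    (hw : 1 / 2 < w.re) (hyi : 0 < y.im) (hwi : 0 < w.im)
    (h : halfPlaneMap β y = halfPlaneMap β w) : y = w := by
  obtain ⟨χ, δ, hχ, hδ, hπ, ey, ey1⟩ := exists_triangle_coordinates hy hyi
  obtain ⟨χ', δ', hχ', hδ', hπ', ew, ew1⟩ := exists_triangle_coordinates hw hwi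
  rw [halfPlaneMap_eq_exp hχ hδ hπ ey ey1, halfPlaneMap_eq_exp hχ' hδ' hπ' ew ew1] at h
  have h1 := Complex.exp_inj_of_neg_pi_lt_of_le_pi (by simp; nlinarith [Real.pi_pos])
    (by simp; nlinarith) (by simp; nlinarith [Real.pi_pos]) (by simp; nlinarith) h
  have hr := congrArg Complex.re h1
  have hi := congrArg Complex.im h1
  simp only [Complex.add_re, Complex.ofReal_re, Complex.re_ofReal_mul, Complex.I_re, mul_zero,
    add_zero, Complex.add_im, Complex.ofReal_im, Complex.im_ofReal_mul, Complex.I_im, mul_one,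
    zero_add] at hr hi
  have key : ∀ χ χ' δ δ' : ℝ, 0 < χ → 0 < δ → 0 < δ' → 2 * χ + δ < Real.pi →
      2 * χ' + δ' < Real.pi → δ + (1 + β) * χ = δ' + (1 + β) * χ' → χ < χ' →
      triangleModulus β χ δ < triangleModulus β χ' δ' := by
    intro χ χ' δ δ' g1 g2 g3 g4 g5 g6 g7
    have e1 : δ = (δ + (1 + β) * χ) - (1 + β) * χ := by ring
    have e2 : δ' = (δ + (1 + β) * χ) - (1 + β) * χ' := by linarith
    have := strictMonoOn_triangleModulus (β := β) (δ + (1 + β) * χ) (χ₁ := χ) (χ₂ := χ') g1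
      (by rw [← e2]; exact g3) (by rw [← e1]; exact g2) (by rw [← e1]; exact g4)
      (by rw [← e2]; exact g5) (left_mem_Icc.2 g7.le) (right_mem_Icc.2 g7.le) g7
    simp only [← e1, ← e2] at this
    exact this
  have hχeq : χ = χ' := by
    rcases lt_trichotomy χ χ' with hlt | heq | hgt
    · have := key χ χ' δ δ' hχ hδ hδ' hπ hπ' hi hlt
      linarith
    · exact heq
    · have := key χ' χ δ' δ hχ' hδ' hδ hπ' hπ hi.symm hgt
      linarith
  have hδeq : δ = δ' := by rw [hχeq] at hi; linarith
  rw [ey, ew, hχeq, hδeq]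

theorem halfPlaneMap_ofReal {t : ℝ} (ht : 0 < t) :
    halfPlaneMap β (t : ℂ) =
      ((t - 1) * Real.exp (-β * Real.log t + 2 * (1 + β) * (t - 1)) : ℝ) := by
  rw [halfPlaneMap, ← Complex.ofReal_log ht.le, Complex.conj_ofReal, Complex.ofReal_re]
  push_cast; ring_nf

theorem strictMonoOn_halfPlaneMap_real (hβ : -1 < β) (hβ1 : β ≤ 1) :
    StrictMonoOn (fun t : ℝ => (t - 1) * Real.exp (-β * Real.log t + 2 * (1 + β) * (t - 1)))
      (Ioi (1 / 2)) := by
  have hd : ∀ t ∈ Ioi (1 / 2 : ℝ), HasDerivAt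
      (fun t : ℝ => (t - 1) * Real.exp (-β * Real.log t + 2 * (1 + β) * (t - 1)))
      (Real.exp (-β * Real.log t + 2 * (1 + β) * (t - 1)) *
        ((2 * t - 1) * ((1 + β) * t - β) / t)) t := by
    intro t ht
    have ht0 : t ≠ 0 := by have : 1 / 2 < t := ht; linarith
    have h1 : HasDerivAt (fun t : ℝ => t - 1) 1 t := (hasDerivAt_id t).sub_const 1
    have h2 := ((Real.hasDerivAt_log ht0).const_mul (-β)).add (h1.const_mul (2 * (1 + β)))
    refine (h1.mul h2.exp).congr_deriv ?_
    simp only [Pi.add_apply]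
    field_simp; ring
  refine strictMonoOn_of_deriv_pos (convex_Ioi _)
    (fun t ht => (hd t ht).continuousAt.continuousWithinAt) fun t ht => ?_
  rw [interior_Ioi] at ht
  rw [(hd t ht).deriv]
  have ht : 1 / 2 < t := ht
  refine mul_pos (Real.exp_pos _) (div_pos (mul_pos (by linarith) (by nlinarith)) (by linarith))

/-- The map preserves the sign of the imaginary part, so only three cases remain: upper part, its
reflection, and the real ray. -/
theorem halfPlaneMap_injOn (hβ : -1 < β) (hβ1 : β ≤ 1) :
    InjOn (halfPlaneMap β) {y | 1 / 2 < y.re} := by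
  intro y hy w hw h
  have hy : 1 / 2 < y.re := hy
  have hw : 1 / 2 < w.re := hw
  have hneg : ∀ v : ℂ, 1 / 2 < v.re → v.im < 0 → (halfPlaneMap β v).im < 0 := by
    intro v hv hvi
    have := halfPlaneMap_im_pos hβ hβ1 (y := conj v) (by simpa using hv) (by simpa using hvi)
    rw [halfPlaneMap_conj hv, Complex.conj_im] at this
    linarith
  have hreal : ∀ v : ℂ, v.im = 0 → v = (v.re : ℂ) := fun v hv => Complex.ext (by simp) (by simp [hv])
  have hzero : ∀ v : ℂ, 1 / 2 < v.re → v.im = 0 → (halfPlaneMap β v).im = 0 := by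
    intro v hv hvi
    rw [hreal v hvi, halfPlaneMap_ofReal (by linarith), Complex.ofReal_im]
  have hpos := fun (v : ℂ) (hv : 1 / 2 < v.re) => halfPlaneMap_im_pos (y := v) hβ hβ1 hv
  have him := congrArg Complex.im h
  rcases lt_trichotomy y.im 0 with hyi | hyi | hyi <;>
    rcases lt_trichotomy w.im 0 with hwi | hwi | hwi
  · have := halfPlaneMap_injective_aux hβ hβ1 (y := conj y) (w := conj w) (by simpa using hy)
      (by simpa using hw) (by simpa using hyi) (by simpa using hwi)
      (by rw [halfPlaneMap_conj hy, halfPlaneMap_conj hw, h])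
    simpa using congrArg conj this
  · linarith [hneg y hy hyi, hzero w hw hwi]
  · linarith [hneg y hy hyi, hpos w hw hwi]
  · linarith [hzero y hy hyi, hneg w hw hwi]
  · rw [hreal y hyi, hreal w hwi, halfPlaneMap_ofReal (by linarith),
      halfPlaneMap_ofReal (by linarith), Complex.ofReal_inj] at h
    have := (strictMonoOn_halfPlaneMap_real hβ hβ1).injOn hy hw h
    rw [hreal y hyi, hreal w hwi, this]
  · linarith [hzero y hy hyi, hpos w hw hwi]
  · linarith [hpos y hy hyi, hneg w hw hwi]
  · linarith [hpos y hy hyi, hzero w hw hwi]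
  · exact halfPlaneMap_injective_aux hβ hβ1 hy hw hyi hwi h

end Injectivity

/-! ### The extremal mapping -/

/-- The function `(c x / (1 - x) - d log (1 - x)) / k`. -/
noncomputable def logGeometric (k : ℕ) (c d : ℝ) (x : ℂ) : ℂ :=
  (c * (x / (1 - x)) - d * Complex.log (1 - x)) / k

/-- The Taylor coefficients of `logGeometric`. -/
noncomputable def logGeometricCoeff (k : ℕ) (c d : ℝ) (n : ℕ) : ℂ :=
  if n = 0 then 0 else (((c + d / n) / k : ℝ) : ℂ)

section LogGeometric

variable {k : ℕ} {c d : ℝ}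

theorem one_sub_mem_slitPlane {x : ℂ} (hx : x ∈ ball (0 : ℂ) 1) : 1 - x ∈ Complex.slitPlane := by
  have h1 : ‖x‖ < 1 := by simpa using hx
  have h2 := Complex.re_le_norm x
  refine Complex.mem_slitPlane_iff.2 (Or.inl ?_)
  simp only [Complex.sub_re, Complex.one_re]
  linarith

theorem hasDiskSeries_logGeometric :
    HasDiskSeries (logGeometric k c d) (logGeometricCoeff k c d) := by
  intro x hx
  have hx1 : ‖x‖ < 1 := by simpa using hx
  have h1 := (hasSum_geometric_of_norm_lt_one hx1).mul_left ((c : ℂ) * x)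
  have h2 := Complex.hasSum_taylorSeries_neg_log hx1
  rw [← hasSum_nat_add_iff' 1] at h2 ⊢
  have h3 := (h1.add (h2.mul_left (d : ℂ))).div_const (k : ℂ)
  convert! h3 using 1
  · funext n
    simp only [logGeometricCoeff, Nat.succ_ne_zero, if_false, pow_succ]
    push_cast
    ring
  · simp [logGeometric, logGeometricCoeff]
    ring

theorem mul_deriv_logGeometric {x : ℂ} (hx : x ∈ ball (0 : ℂ) 1) (hk : 1 ≤ k) :
    k * (x * deriv (logGeometric k c d) x) = c * x / (1 - x) ^ 2 + d * x / (1 - x) := by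
  have hs := one_sub_mem_slitPlane hx
  have hne : 1 - x ≠ 0 := Complex.slitPlane_ne_zero hs
  have hk0 : (k : ℂ) ≠ 0 := by exact_mod_cast (by omega : k ≠ 0)
  have h1 : HasDerivAt (fun x : ℂ => 1 - x) (-1) x := (hasDerivAt_id x).const_sub 1
  have h2 : HasDerivAt (logGeometric k c d)
      ((c * ((1 * (1 - x) - x * -1) / (1 - x) ^ 2) - d * (-1 / (1 - x))) / k) x :=
    ((((hasDerivAt_id x).div h1 hne).const_mul (c : ℂ)).sub
      ((h1.clog hs).const_mul (d : ℂ))).div_const _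
  rw [h2.deriv]
  field_simp
  ring

theorem logGeometric_ofReal {x : ℝ} (hx : x < 1) : logGeometric k c d (x : ℂ)
    = ((c * (x / (1 - x)) - d * Real.log (1 - x)) / k : ℝ) := by
  rw [logGeometric]
  push_cast [Complex.ofReal_log (by linarith : 0 ≤ 1 - x)]
  rfl

theorem continuousAt_logGeometric_neg_one : ContinuousAt (logGeometric k c d) (-1) := by
  have h : (1 : ℂ) - -1 = 2 := by norm_num
  have h1 : ContinuousAt (fun x : ℂ => 1 - x) (-1) := by fun_prop
  have h2 : ContinuousAt (fun x : ℂ => Complex.log (1 - x)) (-1) :=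
    h1.clog (by rw [h]; exact Complex.mem_slitPlane_iff.2 (Or.inl (by simp)))
  unfold logGeometric
  exact ((continuousAt_const.mul (continuousAt_id.div h1 (by rw [h]; exact two_ne_zero))).sub
    (continuousAt_const.mul h2)).div_const _

end LogGeometric

/-- The exponent `log h` of the extremal mapping, in the variable `z ^ k`. -/
noncomputable def extremalA (k : ℕ) (α : ℝ) : ℂ → ℂ := logGeometric k (2 * (1 - α)) 1

/-- The exponent `log g` of the extremal mapping, in the variable `z ^ k`. -/
noncomputable def extremalB (k : ℕ) (α : ℝ) : ℂ → ℂ := logGeometric k (2 * (1 - α)) (2 * α - 1)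

/-- The extremal mapping. -/
noncomputable def extremalMap (k : ℕ) (α : ℝ) (z : ℂ) : ℂ :=
  z * Complex.exp (extremalA k α (z ^ k)) * conj (Complex.exp (extremalB k α (z ^ k)))

theorem hasExponents_extremalMap (k : ℕ) (α : ℝ) :
    HasExponents k (extremalA k α) (extremalB k α) (extremalMap k α) := fun _ _ => rfl

section Extremal

variable {k : ℕ} {α : ℝ}

theorem one_add_mul_deriv_extremalA (hk : 1 ≤ k) {x : ℂ} (hx : x ∈ ball (0 : ℂ) 1) :
    1 + k * (x * deriv (extremalA k α) x) = (1 + (1 - 2 * α) * x) / (1 - x) ^ 2 := by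
  have hne : 1 - x ≠ 0 := Complex.slitPlane_ne_zero (one_sub_mem_slitPlane hx)
  rw [extremalA, mul_deriv_logGeometric hx hk]
  push_cast
  field_simp
  ring

theorem mul_deriv_extremalB (hk : 1 ≤ k) {x : ℂ} (hx : x ∈ ball (0 : ℂ) 1) :
    k * (x * deriv (extremalB k α) x) = x * ((1 + (1 - 2 * α) * x) / (1 - x) ^ 2) := by
  have hne : 1 - x ≠ 0 := Complex.slitPlane_ne_zero (one_sub_mem_slitPlane hx)
  rw [extremalB, mul_deriv_logGeometric hx hk]
  push_cast
  field_simp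
  ring

/-- Here `V = x U`, so the dilatation is `z^k`, and `U - V = (1 + (1 - 2α) x) / (1 - x)` maps the
disk into `Re > α`. -/
theorem isStarlikePair_extremal (hk : 1 ≤ k) (hα0 : 0 ≤ α) (hα1 : α < 1) :
    IsStarlikePair k α (extremalA k α) (extremalB k α) := by
  have hre : ∀ x ∈ ball (0 : ℂ) 1, α < ((1 + (1 - 2 * α) * x) / (1 - x)).re := by
    intro x hx
    have hne : 1 - x ≠ 0 := Complex.slitPlane_ne_zero (one_sub_mem_slitPlane hx)
    have hns := Complex.normSq_pos.2 hne
    have hx1 : Complex.normSq x < 1 := by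
      rw [Complex.normSq_eq_norm_sq]
      have : ‖x‖ < 1 := by simpa using hx
      exact pow_lt_one₀ (norm_nonneg x) this two_ne_zero
    rw [Complex.div_re, ← add_div, lt_div_iff₀ hns]
    rw [Complex.normSq_apply] at hx1 ⊢
    have e : (1 - 2 * (α : ℂ)) = ((1 - 2 * α : ℝ) : ℂ) := by push_cast; ring
    rw [e]
    simp only [Complex.add_re, Complex.sub_re, Complex.one_re, Complex.add_im, Complex.sub_im,
      Complex.one_im, Complex.re_ofReal_mul, Complex.im_ofReal_mul]
    nlinarith [mul_pos (sub_pos.2 hα1) (sub_pos.2 hx1)]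
  refine ⟨hasDiskSeries_logGeometric.differentiableOn, hasDiskSeries_logGeometric.differentiableOn,
    by simp [extremalA, logGeometric], by simp [extremalB, logGeometric], ?_, ?_⟩
  · intro x hx
    have hne : 1 - x ≠ 0 := Complex.slitPlane_ne_zero (one_sub_mem_slitPlane hx)
    rw [one_add_mul_deriv_extremalA hk hx, mul_deriv_extremalB hk hx]
    convert! hre x hx using 2
    field_simp
  · intro x hx
    have hne : 1 - x ≠ 0 := Complex.slitPlane_ne_zero (one_sub_mem_slitPlane hx)
    rw [one_add_mul_deriv_extremalA hk hx, mul_deriv_extremalB hk hx, norm_mul]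
    refine mul_lt_of_lt_one_left (norm_pos_iff.2 (div_ne_zero ?_ (pow_ne_zero 2 hne)))
      (by simpa using hx)
    intro h0
    have := hre x hx
    rw [h0] at this
    simp at this
    linarith

/-- The `k`-th power clears the factors `1/k` in the exponents and leaves a function of `z^k` alone,
with `1 + β = 2 (1 - α)`. -/
theorem extremalMap_pow (hk : 1 ≤ k) {z : ℂ} (hz : z ∈ ball (0 : ℂ) 1) :
    extremalMap k α z ^ k = halfPlaneMap (1 - 2 * α) (1 - z ^ k)⁻¹ := by
  have hx := pow_mem_ball_zero_one hk hz
  have hs := one_sub_mem_slitPlane hx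
  have hne : 1 - z ^ k ≠ 0 := Complex.slitPlane_ne_zero hs
  have hk0 : (k : ℂ) ≠ 0 := by exact_mod_cast (by omega : k ≠ 0)
  rw [extremalMap, halfPlaneMap, mul_pow, mul_pow, ← map_pow, ← Complex.exp_nat_mul,
    ← Complex.exp_nat_mul, extremalA, extremalB, logGeometric, logGeometric,
    Complex.log_inv _ (Complex.slitPlane_arg_ne_pi hs), mul_div_cancel₀ _ hk0,
    mul_div_cancel₀ _ hk0, ← Complex.exp_conj]
  set x := z ^ k
  have h1 : (1 - x)⁻¹ - 1 = x * Complex.exp (-Complex.log (1 - x)) := by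
    rw [Complex.exp_neg, Complex.exp_log hne]; field_simp; ring
  have h2 : x / (1 - x) = (1 - x)⁻¹ - 1 := by field_simp; ring
  rw [h1, mul_assoc, mul_assoc, ← Complex.exp_add, ← Complex.exp_add, h2]
  congr 2
  have h3 : (((1 - x)⁻¹.re : ℝ) : ℂ) = ((1 - x)⁻¹ + conj (1 - x)⁻¹) / 2 :=
    Complex.re_eq_add_conj _
  rw [h3]
  simp only [map_sub, map_mul, Complex.conj_ofReal, map_one, map_neg]
  push_cast
  ring

theorem extremalMap_injOn (hk : 1 ≤ k) (hα0 : 0 ≤ α) (hα1 : α < 1) :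
    InjOn (extremalMap k α) (ball 0 1) := by
  intro z hz w hw h
  have hre : ∀ x ∈ ball (0 : ℂ) 1, (1 - x)⁻¹ ∈ {y : ℂ | 1 / 2 < y.re} := by
    intro x hx
    have hne : 1 - x ≠ 0 := Complex.slitPlane_ne_zero (one_sub_mem_slitPlane hx)
    have hns := Complex.normSq_pos.2 hne
    have hx1 : Complex.normSq x < 1 := by
      rw [Complex.normSq_eq_norm_sq]
      have : ‖x‖ < 1 := by simpa using hx
      exact pow_lt_one₀ (norm_nonneg x) this two_ne_zero
    change 1 / 2 < (1 - x)⁻¹.re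
    rw [Complex.inv_re, lt_div_iff₀ hns]
    rw [Complex.normSq_apply] at hx1 ⊢
    simp only [Complex.sub_re, Complex.one_re, Complex.sub_im, Complex.one_im]
    linarith
  have h1 : halfPlaneMap (1 - 2 * α) (1 - z ^ k)⁻¹ = halfPlaneMap (1 - 2 * α) (1 - w ^ k)⁻¹ := by
    rw [← extremalMap_pow hk hz, ← extremalMap_pow hk hw, h]
  have h2 := halfPlaneMap_injOn (by linarith) (by linarith)
    (hre _ (pow_mem_ball_zero_one hk hz)) (hre _ (pow_mem_ball_zero_one hk hw)) h1
  -- The exponential factors depend on `z^k` only, so they agree and cancel, leaving `z = w`.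
  have h3 : z ^ k = w ^ k := by simpa using h2
  rw [extremalMap, extremalMap, h3] at h
  exact mul_right_cancel₀ (Complex.exp_ne_zero _)
    (mul_right_cancel₀ ((map_ne_zero _).2 (Complex.exp_ne_zero _)) h)

theorem boundaryDist_extremalMap_le (hk : 1 ≤ k) (hα0 : 0 ≤ α) (hα1 : α < 1) :
    boundaryDist (extremalMap k α) ≤ coveringRadius k α := by
  have hk0 : (k : ℂ) ≠ 0 := by exact_mod_cast (by omega : k ≠ 0)
  -- With `e^k = -1` the exponents are continuous at `e^k`, so the radial limit exists; its modulus
  -- is `coveringRadius`.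
  set e := Complex.exp (((Real.pi / k : ℝ) : ℂ) * Complex.I) with he
  have hen : ‖e‖ = 1 := Complex.norm_exp_ofReal_mul_I _
  have hek : e ^ k = -1 := by
    rw [he, ← Complex.exp_nat_mul, ← Complex.exp_pi_mul_I]
    congr 1; push_cast; field_simp
  have hu : Tendsto (fun t : ℝ => (t : ℂ) * e) (𝓝[<] 1) (𝓝 e) := by
    have : Continuous fun t : ℝ => (t : ℂ) * e := by fun_prop
    simpa using (this.tendsto 1).mono_left nhdsWithin_le_nhds
  have hc : ContinuousAt (extremalMap k α) e := by
    have hp : ContinuousAt (fun z : ℂ => z ^ k) e := by fun_prop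
    have hA : ContinuousAt (fun z : ℂ => extremalA k α (z ^ k)) e :=
      ContinuousAt.comp (g := extremalA k α) (by
        rw [hek]; exact continuousAt_logGeometric_neg_one) hp
    have hB : ContinuousAt (fun z : ℂ => extremalB k α (z ^ k)) e :=
      ContinuousAt.comp (g := extremalB k α) (by
        rw [hek]; exact continuousAt_logGeometric_neg_one) hp
    exact (continuousAt_id.mul hA.cexp).mul (Complex.continuous_conj.continuousAt.comp hB.cexp)
  refine ((isStarlikePair_extremal hk hα0 hα1).boundaryDist_le hk (hasExponents_extremalMap k α)
    (extremalMap_injOn hk hα0 hα1) (u := fun t : ℝ => (t : ℂ) * e) (l := 𝓝[<] (1 : ℝ)) ?_ hen hu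
    (hc.tendsto.comp hu)).trans_eq ?_
  · filter_upwards [Ioo_mem_nhdsLT (zero_lt_one' ℝ)] with t ht
    simpa [hen, abs_of_pos ht.1] using ht.2
  · have e1 : (-1 : ℂ) = ((-1 : ℝ) : ℂ) := by simp
    rw [extremalMap, norm_mul, norm_mul, RCLike.norm_conj, hen, one_mul, Complex.norm_exp,
      Complex.norm_exp, ← Real.exp_add, hek, extremalA, extremalB, e1,
      logGeometric_ofReal (by norm_num), logGeometric_ofReal (by norm_num), Complex.ofReal_re,
      Complex.ofReal_re, coveringRadius]
    norm_num
    ring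

/-- With `θ = 0` and `z` on the positive axis all coefficients of `A`, `B` add without cancellation,
and every estimate in the upper bound is an equality. -/
theorem sharpMajorant_eq_bohrMajorant (hk : 1 ≤ k) (hα0 : 0 ≤ α) (hα1 : α < 1) {r : ℝ}
    (hr : r ∈ Ico (0 : ℝ) 1) :
    bohrMajorant k (extremalMap k α) (fun m => logGeometricCoeff k (2 * (1 - α)) 1 (m / k))
      (fun m => logGeometricCoeff k (2 * (1 - α)) (2 * α - 1) (m / k)) 0 (r : ℂ)
      = sharpMajorant k α r := by
  have hP := isStarlikePair_extremal hk hα0 hα1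
  have hz : (r : ℂ) ∈ ball (0 : ℂ) 1 := by simpa [abs_of_nonneg hr.1] using hr.2
  have hx := pow_lt_one_of_mem_Ico hk hr
  have hzr : ‖(r : ℂ)‖ = r := by rw [Complex.norm_real, Real.norm_of_nonneg hr.1]
  have hk0 : (0 : ℝ) < k := by exact_mod_cast (by omega : 0 < k)
  have hterm : ∀ n, bohrTerm k (fun m => logGeometricCoeff k (2 * (1 - α)) 1 (m / k))
      (fun m => logGeometricCoeff k (2 * (1 - α)) (2 * α - 1) (m / k)) 0 (r : ℂ) n =
      (4 * (1 - α) + 2 * α / (n + 1)) / k * (r ^ k) ^ (n + 1) := by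
    intro n
    rw [bohrTerm, hzr, ← pow_mul, mul_comm k]
    simp only [Nat.mul_div_cancel _ (show 0 < k by omega), logGeometricCoeff, Nat.succ_ne_zero,
      if_false, Complex.ofReal_zero, zero_mul, Complex.exp_zero, one_mul]
    rw [← Complex.ofReal_add, Complex.norm_real]
    have e : (2 * (1 - α) + 1 / ((n + 1 : ℕ) : ℝ)) / k +
        (2 * (1 - α) + (2 * α - 1) / ((n + 1 : ℕ) : ℝ)) / k
        = (4 * (1 - α) + 2 * α / (n + 1)) / k := by
      push_cast; field_simp; ring
    have : 0 ≤ 1 - α := by linarith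
    rw [e, Real.norm_of_nonneg (by positivity)]
  have ht : ∑' n, bohrTerm k (fun m => logGeometricCoeff k (2 * (1 - α)) 1 (m / k))
      (fun m => logGeometricCoeff k (2 * (1 - α)) (2 * α - 1) (m / k)) 0 (r : ℂ) n
      = growthExponent k α (r ^ k) := by
    simp only [hterm]
    exact (hasSum_log_geometric k (4 * (1 - α)) (2 * α) hx).tsum_eq
  have hf := hasExponents_extremalMap k α
  have hA : (extremalA k α ((r : ℂ) ^ k)).re + (extremalB k α ((r : ℂ) ^ k)).re
      = growthExponent k α (r ^ k) := by
    rw [← Complex.ofReal_pow, extremalA, extremalB, logGeometric_ofReal hx.2,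
      logGeometric_ofReal hx.2, Complex.ofReal_re, Complex.ofReal_re, growthExponent]
    ring
  have hU : ‖1 + k * ((r : ℂ) ^ k * deriv (extremalA k α) ((r : ℂ) ^ k))‖
      = (1 + (1 - 2 * α) * r ^ k) / (1 - r ^ k) ^ 2 := by
    rw [one_add_mul_deriv_extremalA hk (pow_mem_ball_zero_one hk hz)]
    have h1 : 0 ≤ 1 + (1 - 2 * α) * r ^ k := by nlinarith [hx.1, hx.2]
    rw [← Real.norm_of_nonneg (show 0 ≤ (1 + (1 - 2 * α) * r ^ k) / (1 - r ^ k) ^ 2 by positivity),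
      ← Complex.norm_real]
    push_cast
    rfl
  rw [bohrMajorant, hf.mul_wirtingerZ hk hP.diffA hP.diffB hz, norm_mul, hf.norm_eq hz, ht, hA,
    hU, hzr, sharpMajorant]
  ring

end Extremal

/-! ### Conclusion -/

theorem mainTheorem6 (k : ℕ) (hk : 1 ≤ k) (α : ℝ) (hα0 : 0 ≤ α) (hα1 : α < 1) :
    ∃ r₆ : ℝ,
      (r₆ ∈ Set.Ioo (0 : ℝ) 1 ∧ radiusFunction k α r₆ = 1 ∧
        ∀ r ∈ Set.Ioo (0 : ℝ) 1, radiusFunction k α r = 1 → r = r₆) ∧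
      (∀ (f h g ω : ℂ → ℂ) (a b : ℕ → ℂ), IsSLHkStar k α f h g ω a b → ω 0 = 0 →
        ∀ (θ : ℝ) (z : ℂ), ‖z‖ ≤ r₆ →
          Summable (bohrTerm k a b θ z) ∧
          bohrMajorant k f a b θ z ≤ boundaryDist f) ∧
      (∀ ρ ∈ Set.Ioo r₆ 1,
        ∃ (f h g ω : ℂ → ℂ) (a b : ℕ → ℂ), IsSLHkStar k α f h g ω a b ∧ ω 0 = 0 ∧
          ∃ (θ : ℝ) (z : ℂ), ‖z‖ = ρ ∧
            boundaryDist f < bohrMajorant k f a b θ z) := by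
  obtain ⟨r₆, hr, hr1⟩ := exists_radius hk hα0 hα1
  have hmono := radiusFunction_strictMonoOn hk hα0 hα1
  have hr' : r₆ ∈ Ico (0 : ℝ) 1 := Ioo_subset_Ico_self hr
  have hsharp : sharpMajorant k α r₆ = coveringRadius k α := by
    rw [← coveringRadius_mul_radiusFunction hk α hr', hr1, mul_one]
  refine ⟨r₆, ⟨hr, hr1, fun r hrI h1 => hmono.injOn (Ioo_subset_Ico_self hrI) hr'
    (h1.trans hr1.symm)⟩, ?_, ?_⟩
  · intro f h g ω a b hS _ θ z hz
    obtain ⟨A, B, hP, hf, hA, hB⟩ := hS.exists_isStarlikePair hk hα0 hα1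
    have hzb : z ∈ ball (0 : ℂ) 1 := by simpa using hz.trans_lt hr.2
    obtain ⟨h1, h2⟩ := bohrMajorant_le hk hα0 hα1 hP hf hA hB θ hzb
    refine ⟨h1, h2.trans (le_trans ?_
      (hP.coveringRadius_le_boundaryDist hk hα0 hα1 hf hS.univalent))⟩
    rw [← hsharp]
    exact (sharpMajorant_strictMonoOn hk hα0 hα1).monotoneOn ⟨norm_nonneg z, by simpa using hzb⟩
      hr' hz
  · intro ρ hρ
    have hρ' : ρ ∈ Ico (0 : ℝ) 1 := ⟨hr.1.le.trans hρ.1.le, hρ.2⟩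
    have hP := isStarlikePair_extremal hk hα0 hα1
    refine ⟨extremalMap k α, _, _, _, _, _, hP.isSLHkStar hk hasDiskSeries_logGeometric
      hasDiskSeries_logGeometric (hasExponents_extremalMap k α) (extremalMap_injOn hk hα0 hα1),
      ?_, 0, (ρ : ℂ), ?_, ?_⟩
    · simp [show k ≠ 0 by omega]
    · rw [Complex.norm_real, Real.norm_of_nonneg hρ'.1]
    · rw [sharpMajorant_eq_bohrMajorant hk hα0 hα1 hρ']
      refine (boundaryDist_extremalMap_le hk hα0 hα1).trans_lt ?_
      rw [← hsharp]
      exact sharpMajorant_strictMonoOn hk hα0 hα1 hr' hρ' hρ.1
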